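/- Conventions. Groups are discrete. A group $\Gamma$ is just-infinite if it is infinite and every non-trivial normal subgroup of $\Gamma$ has finite index; icc if every conjugacy class other than $\{1\}$ is infinite; amenable if $\ell^\infty(\Gamma)$ admits a left-invariant mean. Let $\lambda_\Gamma$ be the left regular representation on $\ell^2(\Gamma)$; for a unitary representation $\pi$ of $\Gamma$ on a non-zero Hilbert space $H_\pi$, let $C^*_\pi(\Gamma)\subset B(H_\pi)$ be the $C^*$-algebra generated by $\pi(\Gamma)$. $\Gamma$ is $C^*$-simple if $C^*_{\lambda_\Gamma}(\Gamma)$ has no closed two-sided ideals other than $0$ and itself. $\Gamma$ acts on $B(H_\pi)$ by $x\mapsto \pi(g)x\pi(g)^*$. We write $\pi\prec\lambda_\Gamma$ if $\lambda_\Gamma(g)\mapsto\pi(g)$ extends to a $*$-representation of $C^*_{\lambda_\Gamma}(\Gamma)$, again denoted $\pi$. An invariant unital $C^*$-subalgebra $A\subset C^*_\pi(\Gamma)$ is co-finite in $C^*_\pi(\Gamma)$ if its commutant $A'\subset B(H_\pi)$ admits a normal $\Gamma$-invariant state. Finally, $\Gamma$ is nc-just-infinite if it is infinite and, for every $\Gamma$-invariant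 unital $C^*$-subalgebra $A\neq\mathbb{C}1$ of $C^*_{\lambda_\Gamma}(\Gamma)$ and every $\pi\prec\lambda_\Gamma$, $\pi(A)$ is co-finite in $C^*_\pi(\Gamma)$. Proposition. Let $\Gamma$ be an nc-just-infinite group. Then (i) $\Gamma$ is amenable or $C^*$-simple; (ii) $\Gamma$ is icc. Moreover: (a) there is a simple non-amenable group that is just-infinite but not nc-just-infinite; (b) the group $\mathbb{Z}$ is just-infinite but not nc-just-infinite. -/

import Mathlib

noncomputable section

namespace NCJI

open scoped ENNReal ComplexOrder InnerProductSpace lp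

universe u v

section Representations

variable {Γ : Type u} [Group Γ]
variable {H : Type v} [NormedAddCommGroup H] [InnerProductSpace ℂ H] [CompleteSpace H]

/-- `C*_π(Γ)`: the C*-algebra generated by the unitaries `π(g)`, `g ∈ Γ`, in `B(H)`, for a unitary
representation `π` of the discrete group `Γ` on the Hilbert space `H`. -/
def groupCStar (π : Γ →* unitary (H →L[ℂ] H)) : StarSubalgebra ℂ (H →L[ℂ] H) :=
  (StarAlgebra.adjoin ℂ (Set.range fun g : Γ => (π g : H →L[ℂ] H))).topologicalClosure

theorem rep_mem_groupCStar (π : Γ →* unitary (H →L[ℂ] H)) (g : Γ) :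
    (π g : H →L[ℂ] H) ∈ groupCStar π :=
  StarSubalgebra.le_topologicalClosure _ (StarAlgebra.subset_adjoin ℂ _ ⟨g, rfl⟩)

/-- The unitary `π(g)`, as an element of `C*_π(Γ)`. -/
def groupCStarOf (π : Γ →* unitary (H →L[ℂ] H)) (g : Γ) : groupCStar π :=
  ⟨(π g : H →L[ℂ] H), rep_mem_groupCStar π g⟩

/-- The commutant `A' ⊆ B(H)` of a star subalgebra `A` of `B(H)`. -/
def commutant (A : StarSubalgebra ℂ (H →L[ℂ] H)) : StarSubalgebra ℂ (H →L[ℂ] H) :=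
  StarSubalgebra.centralizer ℂ (A : Set (H →L[ℂ] H))

/-- A state on a unital star subalgebra of `B(H)`: a positive unital linear functional. -/
def IsState {M : StarSubalgebra ℂ (H →L[ℂ] H)} (φ : M →ₗ[ℂ] ℂ) : Prop :=
  φ 1 = 1 ∧ ∀ x : M, 0 ≤ φ (star x * x)

/-- Normality, i.e. σ-weak (ultraweak) continuity: `φ(x) = ∑ₙ ⟪ξₙ, x ηₙ⟫` for two
square-summable sequences of vectors. -/
def IsNormal {M : StarSubalgebra ℂ (H →L[ℂ] H)} (φ : M →ₗ[ℂ] ℂ) : Prop :=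
  ∃ ξ η : ℕ → H, (Summable fun n => ‖ξ n‖ ^ 2) ∧ (Summable fun n => ‖η n‖ ^ 2) ∧
    ∀ x : M, HasSum (fun n => ⟪ξ n, (x : H →L[ℂ] H) (η n)⟫_ℂ) (φ x)

/-- Invariance of a functional on `M` under the action `x ↦ π(g) x π(g)*` of `Γ`. -/
def IsInvariantFunctional (π : Γ →* unitary (H →L[ℂ] H)) {M : StarSubalgebra ℂ (H →L[ℂ] H)}
    (φ : M →ₗ[ℂ] ℂ) : Prop :=
  ∀ (g : Γ) (x y : M),
    (y : H →L[ℂ] H) = (π g : H →L[ℂ] H) * (x : H →L[ℂ] H) * star (π g : H →L[ℂ] H) →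
    φ y = φ x

/-- `A` is co-finite in `C*_π(Γ)`: the commutant `A' ⊆ B(H)` admits a normal `Γ`-invariant state.
(Used for `Γ`-invariant `A`, for which `A'` is `Γ`-invariant as well.) -/
def IsCoFinite (π : Γ →* unitary (H →L[ℂ] H)) (A : StarSubalgebra ℂ (H →L[ℂ] H)) : Prop :=
  ∃ φ : commutant A →ₗ[ℂ] ℂ, IsState φ ∧ IsNormal φ ∧ IsInvariantFunctional π φ

end Representations

section Regular

variable (Γ : Type u) [Group Γ]

theorem memℓp_translate (g : Γ) (f : ℓ²(Γ, ℂ)) :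
    Memℓp (fun h : Γ => f (g⁻¹ * h)) 2 := by
  have h2 : 0 < (2 : ℝ≥0∞).toReal := by norm_num
  have hf := (memℓp_gen_iff h2).1 (lp.memℓp f)
  exact (memℓp_gen_iff h2).2 ((Equiv.mulLeft g⁻¹).summable_iff.2 hf)

/-- Left translation on `ℓ²(Γ)`: `(λ(g) f)(h) = f(g⁻¹ h)`, so that `λ(g) δ_h = δ_{gh}`. -/
def translate (g : Γ) : ℓ²(Γ, ℂ) ≃ₗᵢ[ℂ] ℓ²(Γ, ℂ) where
  toFun f := ⟨fun h => f (g⁻¹ * h), memℓp_translate Γ g f⟩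
  invFun f := ⟨fun h => f (g * h), by
    have h := memℓp_translate Γ g⁻¹ f
    rw [inv_inv] at h
    exact h⟩
  map_add' _ _ := rfl
  map_smul' _ _ := rfl
  left_inv f := by
    apply lp.ext; funext h
    change f (g⁻¹ * (g * h)) = f h
    rw [inv_mul_cancel_left]
  right_inv f := by
    apply lp.ext; funext h
    change f (g * (g⁻¹ * h)) = f h
    rw [mul_inv_cancel_left]
  norm_map' f := by
    have h2 : 0 < (2 : ℝ≥0∞).toReal := by norm_num
    rw [lp.norm_eq_tsum_rpow h2, lp.norm_eq_tsum_rpow h2]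
    congr 1
    exact (Equiv.mulLeft g⁻¹).tsum_eq (fun h => ‖f h‖ ^ (2 : ℝ≥0∞).toReal)

@[simp]
theorem translate_apply (g h : Γ) (f : ℓ²(Γ, ℂ)) : translate Γ g f h = f (g⁻¹ * h) := rfl

/-- The left regular representation `λ_Γ` of `Γ` on `ℓ²(Γ)`. -/
def leftRegular : Γ →* unitary (ℓ²(Γ, ℂ) →L[ℂ] ℓ²(Γ, ℂ)) :=
  (Unitary.linearIsometryEquiv (𝕜 := ℂ) (H := ℓ²(Γ, ℂ))).symm.toMonoidHom.comp
    { toFun := translate Γ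
      map_one' := by
        ext f : 1
        apply lp.ext; funext h
        simp
      map_mul' := fun a b => by
        ext f : 1
        apply lp.ext; funext h
        simp [mul_assoc] }

theorem leftRegular_apply (g h : Γ) (f : ℓ²(Γ, ℂ)) :
    (leftRegular Γ g : ℓ²(Γ, ℂ) →L[ℂ] ℓ²(Γ, ℂ)) f h = f (g⁻¹ * h) := rfl

/-- The reduced group C*-algebra `C*_λ(Γ)`. -/
abbrev ReducedCStar : StarSubalgebra ℂ (ℓ²(Γ, ℂ) →L[ℂ] ℓ²(Γ, ℂ)) :=
  groupCStar (leftRegular Γ)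

/-- The unitary `λ(g)`, as an element of `C*_λ(Γ)`. -/
abbrev regularOf (g : Γ) : ReducedCStar Γ := groupCStarOf (leftRegular Γ) g

variable {Γ} in
/-- `ρ : C*_λ(Γ) → B(H)` is a representation extending `λ(g) ↦ π(g)`. Such a `ρ` exists exactly
when `π` is weakly contained in `λ_Γ`, and it is then unique. -/
def Extends {H : Type v} [NormedAddCommGroup H] [InnerProductSpace ℂ H] [CompleteSpace H]
    (π : Γ →* unitary (H →L[ℂ] H)) (ρ : ReducedCStar Γ →⋆ₐ[ℂ] (H →L[ℂ] H)) : Prop :=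
  ∀ g : Γ, ρ (regularOf Γ g) = (π g : H →L[ℂ] H)

/-- `Γ` is nc-just-infinite: it is infinite, and for every closed `Γ`-invariant unital star
subalgebra `A ≠ ℂ1` of `C*_λ(Γ)` and every unitary representation `π` on a nonzero Hilbert space
that is weakly contained in `λ_Γ`, `π(A)` is co-finite in `C*_π(Γ)`. -/
def IsNCJustInfinite : Prop :=
  Infinite Γ ∧
  ∀ A : StarSubalgebra ℂ (ReducedCStar Γ),
    IsClosed (A : Set (ReducedCStar Γ)) → A ≠ ⊥ →
    (∀ g : Γ, ∀ a ∈ A, regularOf Γ g * a * star (regularOf Γ g) ∈ A) →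
    ∀ (H : Type u) [NormedAddCommGroup H] [InnerProductSpace ℂ H] [CompleteSpace H] [Nontrivial H]
      (π : Γ →* unitary (H →L[ℂ] H)) (ρ : ReducedCStar Γ →⋆ₐ[ℂ] (H →L[ℂ] H)),
      Extends π ρ → IsCoFinite π (A.map ρ)

/-- `Γ` is C*-simple: `C*_λ(Γ)` has no closed two-sided ideals besides `0` and itself. -/
def IsCStarSimple : Prop :=
  ∀ I : TwoSidedIdeal (ReducedCStar Γ), IsClosed (I : Set (ReducedCStar Γ)) → I = ⊥ ∨ I = ⊤

/-- `Γ` is amenable: there is a left-invariant mean on `ℓ^∞(Γ)`. -/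
def IsAmenable : Prop :=
  ∃ m : ℓ^∞(Γ, ℝ) →ₗ[ℝ] ℝ,
    m 1 = 1 ∧ (∀ f : ℓ^∞(Γ, ℝ), (∀ h, 0 ≤ f h) → 0 ≤ m f) ∧
    ∀ (g : Γ) (f f' : ℓ^∞(Γ, ℝ)), (∀ h, f' h = f (g⁻¹ * h)) → m f' = m f

/-- `Γ` is icc: every conjugacy class other than that of `1` is infinite. -/
def IsICC : Prop :=
  ∀ g : Γ, g ≠ 1 → (conjugatesOf g).Infinite

/-- `Γ` is just-infinite: it is infinite and its non-trivial normal subgroups have finite index. -/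
def IsJustInfinite : Prop :=
  Infinite Γ ∧ ∀ N : Subgroup Γ, N.Normal → N ≠ ⊥ → N.FiniteIndex

end Regular

end NCJI

end

noncomputable section

namespace NCJI

open scoped ENNReal ComplexOrder InnerProductSpace lp

universe u v

/-! ### States and representations that kill a proper ideal -/

section States

variable {A : Type*} [CStarAlgebra A]

/-! Both (i) and (ii) rest on `IsNCJustInfinite.exists_finiteDimensional`: a representation `ρ` of
`C*_λ(Γ)` with nonzero kernel has a nonzero finite-dimensional invariant subspace. The algebra `A =
ρ⁻¹(ℂ1)` is larger than the scalars, while `ρ(A)` is scalar and has commutant `B(H)`. A normal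
invariant state on `B(H)` is given by a positive nonzero trace-class operator commuting with `Γ`,
and its eigenspaces for nonzero eigenvalues are finite-dimensional and invariant.

For (i), a proper nonzero ideal is killed by a GNS representation, which therefore contains a
finite-dimensional piece. By `isAmenable_of_finiteDimensional` this forces amenability: twisting by
the conjugate coefficients of that piece makes the trivial character bounded on `C*_λ(Γ)`, and a
Hahn-Banach extension of it restricts to an invariant mean on multiplication operators.

For (ii), a finite nontrivial conjugacy class gives a central self-adjoint element with nonzero
positive and negative parts. The kernel of its negative part is a proper invariant subspace on which
a nonzero element of `C*_λ(Γ)` vanishes. It would contain a finite-dimensional subrepresentation of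
`λ`, which an infinite group does not have.

For (a), by (i) it is enough to find a simple group that is neither amenable nor C*-simple. It is
the monolith of a group of almost-everywhere locally translating automorphisms of the Bass-Serre
tree of `ℤ/3 * ℤ/3 * ℤ/3`. The half-spaces of the tree give simplicity by a commutator argument, and
exclude an invariant mean because three of them are disjoint and all would have measure `1/2`. Point
stabilizers are increasing unions of finite groups, so for nontrivial `a`, `b` with disjoint
supports `(1 - a)(1 - b)` generates a proper ideal. For (b), `ℤ` is abelian, hence not icc, which
contradicts (ii). -/

theorem im_apply_eq_zero_of_isSelfAdjoint (f : A →L[ℂ] ℂ) (hf : ‖f‖ ≤ 1) (h1 : f 1 = 1)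
    {a : A} (ha : IsSelfAdjoint a) : (f a).im = 0 := by
  have key : ∀ t : ℝ, (f a).im ^ 2 + 2 * (f a).im * t ≤ ‖a‖ ^ 2 := by
    intro t
    have hn : Nontrivial A := by
      refine ⟨⟨1, 0, fun h => ?_⟩⟩
      rw [h, map_zero] at h1
      exact zero_ne_one h1
    set b : A := a + (Complex.I * t) • (1 : A) with hb
    have hfb : f b = f a + Complex.I * t := by simp [hb, h1]
    have hstar : star b * b = a * a + ((t ^ 2 : ℝ) : ℂ) • (1 : A) := by
      simp only [hb, star_add, star_smul, star_one, ha.star_eq, add_mul, mul_add, smul_mul_assoc,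
        mul_smul_comm, one_mul, mul_one]
      have e1 : star (Complex.I * (t : ℂ)) = -(Complex.I * t) := by simp
      rw [e1]
      have e2 : -(Complex.I * (t : ℂ)) * (Complex.I * t) = ((t ^ 2 : ℝ) : ℂ) := by
        push_cast; linear_combination (-(t : ℂ) ^ 2) * Complex.I_mul_I
      rw [← e2]
      module
    have hnb : ‖b‖ ^ 2 ≤ ‖a‖ ^ 2 + t ^ 2 := by
      rw [sq, ← CStarRing.norm_star_mul_self, hstar]
      refine (norm_add_le _ _).trans ?_
      gcongr
      · rw [sq]; exact norm_mul_le _ _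
      · rw [norm_smul, norm_one, mul_one, Complex.norm_real, Real.norm_of_nonneg (sq_nonneg t)]
    have hle : ‖f b‖ ≤ ‖b‖ := (f.le_opNorm b).trans (mul_le_of_le_one_left (norm_nonneg _) hf)
    have hsq : ‖f b‖ ^ 2 ≤ ‖b‖ ^ 2 := by gcongr
    have hexp : ‖f b‖ ^ 2 = (f a).re ^ 2 + ((f a).im + t) ^ 2 := by
      rw [← Complex.normSq_eq_norm_sq, hfb, Complex.normSq_apply]
      simp; ring
    nlinarith [sq_nonneg (f a).re]
  by_contra hne
  -- `key` is affine in `t` with nonzero slope; at this `t` the linear term alone exceeds `‖a‖ ^ 2`.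
  have h := key ((‖a‖ ^ 2 + 1) / (2 * (f a).im))
  have e : 2 * (f a).im * ((‖a‖ ^ 2 + 1) / (2 * (f a).im)) = ‖a‖ ^ 2 + 1 := by field_simp
  nlinarith [sq_nonneg (f a).im]

/-- For `a ≥ 0` the element `‖a‖ - a` has norm at most `‖a‖`, so `f a` lies in the disc of radius
`‖a‖` about `‖a‖`; being real, it is nonnegative. -/
theorem apply_nonneg_of_norm_le_one [PartialOrder A] [StarOrderedRing A] (f : A →L[ℂ] ℂ)
    (hf : ‖f‖ ≤ 1) (h1 : f 1 = 1) {a : A} (ha : 0 ≤ a) : 0 ≤ f a := by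
  have hsa : IsSelfAdjoint a := IsSelfAdjoint.of_nonneg ha
  have hn : Nontrivial A := by
    refine ⟨⟨1, 0, fun h => ?_⟩⟩
    rw [h, map_zero] at h1
    exact zero_ne_one h1
  have hle : a ≤ algebraMap ℝ A ‖a‖ := hsa.le_algebraMap_norm_self
  have hb : ‖algebraMap ℝ A ‖a‖ - a‖ ≤ ‖a‖ := by
    have := CStarAlgebra.norm_le_norm_of_nonneg_of_le (sub_nonneg.2 hle) (sub_le_self _ ha)
    rwa [norm_algebraMap', Real.norm_of_nonneg (norm_nonneg a)] at this
  have hfb : f (algebraMap ℝ A ‖a‖ - a) = (‖a‖ : ℂ) - f a := by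
    rw [map_sub, Algebra.algebraMap_eq_smul_one, ← Complex.coe_smul, map_smul, h1]
    simp
  have h2 : ‖(‖a‖ : ℂ) - f a‖ ≤ ‖a‖ := by
    rw [← hfb]
    exact ((f.le_opNorm _).trans (mul_le_of_le_one_left (norm_nonneg _) hf)).trans hb
  have h3 := (Complex.abs_re_le_norm _).trans h2
  rw [Complex.sub_re, Complex.ofReal_re] at h3
  rw [Complex.nonneg_iff]
  refine ⟨?_, (im_apply_eq_zero_of_isSelfAdjoint f hf h1 hsa).symm⟩
  have := abs_le.1 h3
  linarith [this.2]

/-- A proper closed two-sided ideal is annihilated by a contractive unital functional. -/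
theorem exists_unital_functional_of_ideal (I : TwoSidedIdeal A) (hI : I ≠ ⊤) :
    ∃ f : A →L[ℂ] ℂ, ‖f‖ ≤ 1 ∧ f 1 = 1 ∧ ∀ a ∈ I, f a = 0 := by
  have hn : Nontrivial A := by
    by_contra h
    rw [not_nontrivial_iff_subsingleton] at h
    refine hI (top_le_iff.1 fun x _ => ?_)
    rw [Subsingleton.elim x 0]
    exact I.zero_mem
  let J : Submodule ℂ A :=
    { carrier := I
      add_mem' := fun h h' => I.add_mem h h'
      zero_mem' := I.zero_mem
      smul_mem' := fun c x hx => by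
        have := I.mul_mem_left (c • 1) x hx
        rwa [smul_mul_assoc, one_mul] at this }
  -- If `‖1 + m‖ < 1`, then `-m` is invertible by the Neumann series, which a proper ideal excludes.
  -- Hence `1` has norm one in the quotient, and a norming functional there pulls back to `f`.
  have hJ : ∀ m ∈ J, 1 ≤ ‖(1 : A) + m‖ := by
    intro m hm
    by_contra! hlt
    have hu := isUnit_one_sub_of_norm_lt_one hlt
    rw [show (1 : A) - (1 + m) = -m by abel] at hu
    obtain ⟨w, hw⟩ := hu
    refine hI (top_le_iff.1 fun x _ => ?_)
    have := I.mul_mem_left (x * ↑w⁻¹) _ (I.neg_mem hm)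
    rwa [← hw, mul_assoc, Units.inv_mul, mul_one] at this
  have hnorm : ‖(Submodule.Quotient.mk 1 : A ⧸ J)‖ = 1 := by
    refine le_antisymm ((Submodule.Quotient.norm_mk_le J 1).trans norm_one.le) ?_
    by_contra! hlt
    obtain ⟨m, hm, hm'⟩ := Submodule.Quotient.norm_mk_lt (S := J) (Submodule.Quotient.mk 1 : A ⧸ J)
      (sub_pos.2 hlt)
    have : m - 1 ∈ J := (Submodule.Quotient.eq J).1 hm
    have := hJ _ this
    rw [add_sub_cancel] at this
    linarith
  obtain ⟨g, hg, hg1⟩ := exists_dual_vector'' ℂ (Submodule.Quotient.mk 1 : A ⧸ J)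
  rw [hnorm] at hg1
  refine ⟨LinearMap.mkContinuous (g.toLinearMap ∘ₗ J.mkQ) 1 fun x => ?_, ?_, ?_, ?_⟩
  · rw [one_mul]
    exact (g.le_opNorm _).trans ((mul_le_of_le_one_left (norm_nonneg _) hg).trans
      (Submodule.Quotient.norm_mk_le J x))
  · exact LinearMap.mkContinuous_norm_le _ zero_le_one _
  · simpa using hg1
  · intro a ha
    have : J.mkQ a = 0 := (Submodule.Quotient.mk_eq_zero J).2 ha
    simp [this]

end States

/-- A proper closed two-sided ideal of a C*-algebra is killed by some nonzero representation. -/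
theorem exists_representation_of_ideal {A : Type u} [CStarAlgebra A] (I : TwoSidedIdeal A)
    (hI : I ≠ ⊤) :
    ∃ (H : Type u) (_ : NormedAddCommGroup H) (_ : InnerProductSpace ℂ H) (_ : CompleteSpace H)
      (_ : Nontrivial H) (ρ : A →⋆ₐ[ℂ] (H →L[ℂ] H)), ∀ a ∈ I, ρ a = 0 := by
  let _ : PartialOrder A := CStarAlgebra.spectralOrder A
  have _ : StarOrderedRing A := CStarAlgebra.spectralOrderedRing A
  obtain ⟨f, hf, h1, hfI⟩ := exists_unital_functional_of_ideal I hI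
  let φ : A →ₚ[ℂ] ℂ := PositiveLinearMap.mk₀ f.toLinearMap
    fun x hx => apply_nonneg_of_norm_le_one f hf h1 hx
  have hφ : ∀ x, φ x = f x := fun _ => rfl
  refine ⟨φ.GNS, inferInstance, inferInstance, inferInstance, ?_, φ.gnsStarAlgHom, ?_⟩
  · have hne : ‖((φ.toPreGNS 1 : φ.PreGNS) : φ.GNS)‖ ≠ 0 := by
      rw [UniformSpace.Completion.norm_coe, PositiveLinearMap.preGNS_norm_def]
      simp [hφ, h1]
    exact ⟨⟨_, 0, norm_ne_zero_iff.1 hne⟩⟩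
  · intro a ha
    ext x
    induction x using UniformSpace.Completion.induction_on with
    | hp => apply isClosed_eq <;> fun_prop
    | ih x =>
      change φ.gnsNonUnitalStarAlgHom a x = 0
      rw [PositiveLinearMap.gnsNonUnitalStarAlgHom_apply_coe, ← norm_eq_zero,
        UniformSpace.Completion.norm_coe, PositiveLinearMap.preGNS_norm_def]
      -- The squared GNS norm of `a x` is the value of `f` at `(a x)* (a x)`, which lies in the
      -- ideal.
      have hm : star (φ.ofPreGNS (φ.leftMulMapPreGNS a x)) *
          φ.ofPreGNS (φ.leftMulMapPreGNS a x) ∈ I := by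
        refine I.mul_mem_left _ _ ?_
        change a * φ.ofPreGNS x ∈ I
        exact I.mul_mem_right _ _ ha
      rw [hφ, hfI _ hm]
      simp

end NCJI

end

noncomputable section

namespace NCJI

open scoped ENNReal ComplexOrder InnerProductSpace lp

universe u v

/-! ### Normal invariant states on `B(H)` and density operators -/

section NormalStates

open InnerProductSpace

variable {H : Type v} [NormedAddCommGroup H] [InnerProductSpace ℂ H] [CompleteSpace H]

theorem summable_norm_mul_norm {E : Type*} [SeminormedAddCommGroup E] {ξ η : ℕ → E} (hξ : Summable fun n => ‖ξ n‖ ^ 2)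
    (hη : Summable fun n => ‖η n‖ ^ 2) : Summable fun n => ‖ξ n‖ * ‖η n‖ := by
  refine Summable.of_nonneg_of_le (fun n => by positivity) (fun n => ?_) (hξ.add hη)
  nlinarith [sq_nonneg (‖ξ n‖ - ‖η n‖), sq_nonneg (‖ξ n‖), sq_nonneg (‖η n‖)]

/-- The trace-class operator `∑ₙ |ηₙ⟩⟨ξₙ|`. -/
def densityOperator (ξ η : ℕ → H) : H →L[ℂ] H := ∑' n, rankOne ℂ (η n) (ξ n)

theorem summable_rankOne {ξ η : ℕ → H} (hξ : Summable fun n => ‖ξ n‖ ^ 2)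
    (hη : Summable fun n => ‖η n‖ ^ 2) :
    Summable fun n => (rankOne ℂ (η n) (ξ n) : H →L[ℂ] H) := by
  refine Summable.of_norm ?_
  simp only [norm_rankOne]
  exact summable_norm_mul_norm hη hξ

theorem isCompactOperator_densityOperator {ξ η : ℕ → H} (hξ : Summable fun n => ‖ξ n‖ ^ 2)
    (hη : Summable fun n => ‖η n‖ ^ 2) : IsCompactOperator (densityOperator ξ η) := by
  refine isCompactOperator_of_tendsto (summable_rankOne hξ hη).hasSum
    (Filter.Eventually.of_forall fun s => ?_)
  refine (compactOperator (RingHom.id ℂ) H H).sum_mem fun n _ => ?_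
  change IsCompactOperator (rankOne ℂ (η n) (ξ n) : H →L[ℂ] H)
  rw [rankOne_def']
  exact (isCompactOperator_of_locallyCompactSpace_dom (innerSL ℂ (ξ n))).clm_comp
    (ContinuousLinearMap.toSpanSingleton ℂ (η n))

theorem hasSum_inner_densityOperator {ξ η : ℕ → H} (hξ : Summable fun n => ‖ξ n‖ ^ 2)
    (hη : Summable fun n => ‖η n‖ ^ 2) (v w : H) :
    HasSum (fun n => ⟪ξ n, rankOne ℂ v w (η n)⟫_ℂ) ⟪w, densityOperator ξ η v⟫_ℂ := by
  have h := (summable_rankOne hξ hη).hasSum.mapL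
    ((innerSL ℂ w).comp (ContinuousLinearMap.apply ℂ H v))
  have e : ∀ n, ⟪ξ n, rankOne ℂ v w (η n)⟫_ℂ =
      (innerSL ℂ w).comp (ContinuousLinearMap.apply ℂ H v) (rankOne ℂ (η n) (ξ n)) := by
    intro n
    simp [mul_comm]
  simp only [e]
  exact h

/-- The sum is the trace of the density operator: expand in a Hilbert basis and exchange the two
absolutely convergent summations. It shows that the operator of a state is nonzero. -/
theorem hasSum_inner_of_densityOperator_eq_zero {ξ η : ℕ → H}
    (hξ : Summable fun n => ‖ξ n‖ ^ 2) (hη : Summable fun n => ‖η n‖ ^ 2)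
    (hT : densityOperator ξ η = 0) : HasSum (fun n => ⟪ξ n, η n⟫_ℂ) 0 := by
  obtain ⟨w, b, -⟩ := exists_hilbertBasis ℂ H
  have hsq : ∀ ζ : ℕ → H, (Summable fun n => ‖ζ n‖ ^ 2) →
      Summable fun p : ℕ × w => ‖⟪b p.2, ζ p.1⟫_ℂ‖ ^ 2 := by
    intro ζ hζ
    have hs : ∀ n, HasSum (fun i => ‖⟪b i, ζ n⟫_ℂ‖ ^ 2) (‖ζ n‖ ^ 2) := by
      intro n
      have := b.hasSum_inner_mul_inner (ζ n) (ζ n)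
      have h2 := Complex.hasSum_re this
      rw [show (⟪ζ n, ζ n⟫_ℂ).re = ‖ζ n‖ ^ 2 from inner_self_eq_norm_sq (𝕜 := ℂ) (ζ n)] at h2
      convert h2 using 2 with i
      rw [← inner_conj_symm (ζ n) (b i), ← Complex.normSq_eq_conj_mul_self, Complex.ofReal_re,
        Complex.normSq_eq_norm_sq]
    rw [summable_prod_of_nonneg (fun p => by positivity)]
    refine ⟨fun n => (hs n).summable, ?_⟩
    simpa only [fun n => (hs n).tsum_eq] using hζ
  have hsum : Summable fun p : ℕ × w => ⟪ξ p.1, b p.2⟫_ℂ * ⟪b p.2, η p.1⟫_ℂ := by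
    refine Summable.of_norm_bounded ((hsq ξ hξ).add (hsq η hη)) fun p => ?_
    rw [norm_mul, norm_inner_symm]
    nlinarith [sq_nonneg (‖⟪b p.2, ξ p.1⟫_ℂ‖ - ‖⟪b p.2, η p.1⟫_ℂ‖),
      sq_nonneg (‖⟪b p.2, ξ p.1⟫_ℂ‖), sq_nonneg (‖⟪b p.2, η p.1⟫_ℂ‖)]
  have hrow : ∀ i : w, HasSum (fun n => ⟪ξ n, b i⟫_ℂ * ⟪b i, η n⟫_ℂ) 0 := by
    intro i
    have := hasSum_inner_densityOperator hξ hη (b i) (b i)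
    rw [hT] at this
    simpa [mul_comm] using this
  have h1 : HasSum (fun n => ⟪ξ n, η n⟫_ℂ) (∑' p : ℕ × w, ⟪ξ p.1, b p.2⟫_ℂ * ⟪b p.2, η p.1⟫_ℂ) :=
    hsum.hasSum.prod_fiberwise fun n => b.hasSum_inner_mul_inner (ξ n) (η n)
  have h2 : HasSum (fun _ : w => (0 : ℂ))
      (∑' p : ℕ × w, ⟪ξ p.1, b p.2⟫_ℂ * ⟪b p.2, η p.1⟫_ℂ) :=
    ((Equiv.prodComm w ℕ).hasSum_iff.2 hsum.hasSum).prod_fiberwise hrow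
  rwa [h2.unique hasSum_zero] at h1

/-- A unitary representation `π` such that `B(H)` has a normal `Ad π`-invariant state has a nonzero
finite-dimensional subrepresentation. -/
theorem exists_finiteDimensional_of_normal_invariant_state {Γ : Type u} [Group Γ]
    (π : Γ →* unitary (H →L[ℂ] H)) (φ : (H →L[ℂ] H) → ℂ) {ξ η : ℕ → H}
    (hξ : Summable fun n => ‖ξ n‖ ^ 2) (hη : Summable fun n => ‖η n‖ ^ 2)
    (hφ : ∀ x : H →L[ℂ] H, HasSum (fun n => ⟪ξ n, x (η n)⟫_ℂ) (φ x)) (h1 : φ 1 = 1)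
    (hpos : ∀ x, 0 ≤ φ (star x * x))
    (hinv : ∀ (g : Γ) (x : H →L[ℂ] H),
      φ ((π g : H →L[ℂ] H) * x * star (π g : H →L[ℂ] H)) = φ x) :
    ∃ V : Submodule ℂ H, FiniteDimensional ℂ V ∧ V ≠ ⊥ ∧
      ∀ (g : Γ), ∀ v ∈ V, (π g : H →L[ℂ] H) v ∈ V := by
  set T := densityOperator ξ η with hTdef
  have hrank : ∀ v w : H, φ (rankOne ℂ v w) = ⟪w, T v⟫_ℂ := fun v w =>
    (hφ _).unique (hasSum_inner_densityOperator hξ hη v w)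
  have hTpos : ∀ v : H, 0 ≤ ⟪v, T v⟫_ℂ := by
    intro v
    by_cases hv : v = 0
    · simp [hv]
    have hh := hpos (rankOne ℂ v v)
    have e : star (rankOne ℂ v v : H →L[ℂ] H) * rankOne ℂ v v =
        rankOne ℂ (((‖v‖ ^ 2 : ℝ) : ℂ) • v) v := by
      rw [ContinuousLinearMap.star_eq_adjoint, adjoint_rankOne]
      ext z
      simp [smul_smul, mul_comm]
    rw [e, hrank, map_smul, inner_smul_right] at hh
    have hv2 : (((‖v‖ ^ 2)⁻¹ : ℝ) : ℂ) * ((‖v‖ ^ 2 : ℝ) : ℂ) = 1 := by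
      rw [← Complex.ofReal_mul, inv_mul_cancel₀ (by positivity), Complex.ofReal_one]
    have hv3 : (0 : ℂ) ≤ (((‖v‖ ^ 2)⁻¹ : ℝ) : ℂ) := by
      rw [Complex.zero_le_real]; positivity
    have := mul_nonneg hv3 hh
    rwa [← mul_assoc, hv2, one_mul] at this
  have hsymm : T.IsSymmetric := by
    rw [LinearMap.isSymmetric_iff_inner_map_self_real]
    intro v
    have := hTpos v
    rw [inner_conj_symm]
    change ⟪v, T v⟫_ℂ = ⟪T v, v⟫_ℂ
    rw [← inner_conj_symm (T v) v]
    exact (Complex.conj_eq_iff_im.2 (Complex.nonneg_iff.1 this).2.symm).symm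
  have hTne : T ≠ 0 := by
    intro h0
    have ha := hφ 1
    rw [h1] at ha
    exact one_ne_zero (ha.unique (hasSum_inner_of_densityOperator_eq_zero hξ hη h0))
  have hcompact : IsCompactOperator T := isCompactOperator_densityOperator hξ hη
  -- Invariance of `φ` on rank-one operators says exactly that `T` commutes with `π`, because `φ` of
  -- a rank-one operator is a matrix coefficient of `T`.
  have hcomm : ∀ (g : Γ) (v : H), T ((π g : H →L[ℂ] H) v) = (π g : H →L[ℂ] H) (T v) := by
    intro g v
    refine ext_inner_left ℂ fun w => ?_
    have e : (π g : H →L[ℂ] H) * rankOne ℂ v (star (π g : H →L[ℂ] H) w) *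
        star (π g : H →L[ℂ] H) = rankOne ℂ ((π g : H →L[ℂ] H) v) w := by
      ext z
      have : (π g : H →L[ℂ] H) (star (π g : H →L[ℂ] H) z) = z := by
        rw [← mul_apply_eq_comp, Unitary.mul_star_self_of_mem (π g).2]
        rfl
      simp only [mul_apply_eq_comp, rankOne_apply, map_smul]
      rw [ContinuousLinearMap.star_eq_adjoint, ContinuousLinearMap.adjoint_inner_left,
        ← ContinuousLinearMap.star_eq_adjoint, this]
    rw [← hrank, ← e, hinv, hrank, ContinuousLinearMap.star_eq_adjoint,
      ContinuousLinearMap.adjoint_inner_left]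
  obtain ⟨μ, hμ, hμ0⟩ : ∃ μ, Module.End.HasEigenvalue (T : Module.End ℂ H) μ ∧ μ ≠ 0 := by
    by_contra! h
    exact hTne ((ContinuousLinearMap.eq_zero_of_forall_hasEigenvalue_eq_zero hcompact hsymm).1 h)
  refine ⟨Module.End.eigenspace (T : Module.End ℂ H) μ,
    ContinuousLinearMap.finite_dimensional_eigenspace hcompact μ hμ0, hμ, fun g v hv => ?_⟩
  rw [Module.End.mem_eigenspace_iff] at hv ⊢
  change T _ = _
  change T v = _ at hv
  rw [hcomm, hv, map_smul]

end NormalStates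

end NCJI

end

noncomputable section

namespace NCJI

open scoped ENNReal ComplexOrder InnerProductSpace lp

universe u v

/-! ### Representations of the reduced group C*-algebra -/

section RegularRepresentations

variable {Γ : Type u} [Group Γ]

instance isClosed_reducedCStar :
    IsClosed (ReducedCStar Γ : Set (ℓ²(Γ, ℂ) →L[ℂ] ℓ²(Γ, ℂ))) :=
  StarSubalgebra.isClosed_topologicalClosure _

theorem regularOf_mul (g h : Γ) : regularOf Γ (g * h) = regularOf Γ g * regularOf Γ h := by
  apply Subtype.ext
  simp [groupCStarOf]

theorem regularOf_one : regularOf Γ 1 = 1 := by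
  apply Subtype.ext
  simp [groupCStarOf]

theorem star_regularOf (g : Γ) : star (regularOf Γ g) = regularOf Γ g⁻¹ := by
  apply Subtype.ext
  simp only [groupCStarOf, map_inv, ← Unitary.star_eq_inv]
  rfl

theorem regularOf_mem_unitary (g : Γ) : regularOf Γ g ∈ unitary (ReducedCStar Γ) := by
  rw [Unitary.mem_iff, star_regularOf, ← regularOf_mul, ← regularOf_mul]
  simp [regularOf_one]

/-- Elements of the reduced C*-algebra are limits of linear combinations of group elements. -/
theorem mem_closure_span_regularOf (x : ReducedCStar Γ) :
    x ∈ closure (Submodule.span ℂ (Set.range (regularOf Γ)) : Set (ReducedCStar Γ)) := by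
  set S := Set.range fun g : Γ => (leftRegular Γ g : ℓ²(Γ, ℂ) →L[ℂ] ℓ²(Γ, ℂ)) with hS
  have hsub : (StarAlgebra.adjoin ℂ S : Set (ℓ²(Γ, ℂ) →L[ℂ] ℓ²(Γ, ℂ))) ⊆
      Submodule.span ℂ S := by
    have hstar : star S = S := by
      ext y
      constructor
      · rintro ⟨g, hg⟩
        refine ⟨g⁻¹, ?_⟩
        rw [← star_star y, ← hg]
        simp only [map_inv, ← Unitary.star_eq_inv]
        rfl
      · rintro ⟨g, hg⟩
        refine ⟨g⁻¹, ?_⟩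
        rw [← hg]
        simp only [map_inv, ← Unitary.star_eq_inv]
        rfl
    have hcl : (Submonoid.closure S : Set (ℓ²(Γ, ℂ) →L[ℂ] ℓ²(Γ, ℂ))) ⊆ S := by
      intro y hy
      induction hy using Submonoid.closure_induction with
      | mem y hy => exact hy
      | one => exact ⟨1, by simp⟩
      | mul y z _ _ hy hz =>
        obtain ⟨g, rfl⟩ := hy
        obtain ⟨h, rfl⟩ := hz
        exact ⟨g * h, by simp⟩
    intro y hy
    have hy' : y ∈ Algebra.adjoin ℂ (S ∪ star S) := hy
    rw [hstar, Set.union_self, ← Subalgebra.mem_toSubmodule, Algebra.adjoin_eq_span] at hy'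
    exact Submodule.span_mono hcl hy'
  have hx : (x : ℓ²(Γ, ℂ) →L[ℂ] ℓ²(Γ, ℂ)) ∈ closure (Submodule.span ℂ S : Set _) :=
    closure_mono hsub x.2
  rw [closure_subtype]
  refine closure_mono ?_ hx
  have himg : (Submodule.span ℂ (Set.range (regularOf Γ))).map
      (ReducedCStar Γ).subtype.toLinearMap = Submodule.span ℂ S := by
    rw [Submodule.map_span, ← Set.range_comp]
    rfl
  intro y hy
  rw [SetLike.mem_coe, ← himg] at hy
  exact hy

theorem isClosed_bot_starSubalgebra {A : Type*} [CStarAlgebra A] :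
    IsClosed ((⊥ : StarSubalgebra ℂ A) : Set A) := by
  have : ((⊥ : StarSubalgebra ℂ A) : Set A) = (Submodule.span ℂ {(1 : A)} : Set A) := by
    ext x
    rw [SetLike.mem_coe, StarSubalgebra.mem_bot, SetLike.mem_coe, Submodule.mem_span_singleton]
    simp [Algebra.algebraMap_eq_smul_one]
  rw [this]
  exact Submodule.closed_of_finiteDimensional _

variable {H : Type u} [NormedAddCommGroup H] [InnerProductSpace ℂ H] [CompleteSpace H]

/-- The unitary representation `g ↦ ρ(λ(g))` obtained from a representation `ρ` of `C*_λ(Γ)`. -/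
def unitaryRep (ρ : ReducedCStar Γ →⋆ₐ[ℂ] (H →L[ℂ] H)) : Γ →* unitary (H →L[ℂ] H) where
  toFun g := ⟨ρ (regularOf Γ g), Unitary.map_mem ρ (regularOf_mem_unitary g)⟩
  map_one' := by
    apply Subtype.ext
    simp [regularOf_one]
  map_mul' g h := by
    apply Subtype.ext
    simp [regularOf_mul]

theorem norm_representation_le (ρ : ReducedCStar Γ →⋆ₐ[ℂ] (H →L[ℂ] H)) (x : ReducedCStar Γ) :
    ‖ρ x‖ ≤ ‖x‖ :=
  NonUnitalStarAlgHom.norm_apply_le ρ x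

theorem continuous_representation (ρ : ReducedCStar Γ →⋆ₐ[ℂ] (H →L[ℂ] H)) : Continuous ρ :=
  AddMonoidHomClass.continuous_of_bound ρ 1 fun x => by
    rw [one_mul]; exact norm_representation_le ρ x

/-- Apply the hypothesis to `A = ρ⁻¹(ℂ1)`. It contains the nonscalar `b`, and it is invariant since
scalars are; as `ρ(A)` is scalar, its commutant is all of `B(H)`. -/
theorem IsNCJustInfinite.exists_finiteDimensional (hΓ : IsNCJustInfinite Γ) [Nontrivial H]
    (ρ : ReducedCStar Γ →⋆ₐ[ℂ] (H →L[ℂ] H)) {b : ReducedCStar Γ} (hb : b ≠ 0) (hρb : ρ b = 0) :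
    ∃ V : Submodule ℂ H, FiniteDimensional ℂ V ∧ V ≠ ⊥ ∧
      ∀ (g : Γ), ∀ v ∈ V, ρ (regularOf Γ g) v ∈ V := by
  set A : StarSubalgebra ℂ (ReducedCStar Γ) := (⊥ : StarSubalgebra ℂ (H →L[ℂ] H)).comap ρ with hA
  have hmem : ∀ x, x ∈ A ↔ ∃ c : ℂ, algebraMap ℂ (H →L[ℂ] H) c = ρ x := by
    intro x
    rw [hA, StarSubalgebra.mem_comap, StarSubalgebra.mem_bot]
    rfl
  have hclosed : IsClosed (A : Set (ReducedCStar Γ)) :=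
    isClosed_bot_starSubalgebra.preimage (continuous_representation ρ)
  have hne : A ≠ ⊥ := by
    intro h
    have hbA : b ∈ A := (hmem b).2 ⟨0, by simp [hρb]⟩
    rw [h, StarSubalgebra.mem_bot] at hbA
    obtain ⟨c, rfl⟩ := hbA
    rw [AlgHomClass.commutes] at hρb
    have hc : c = 0 := (FaithfulSMul.algebraMap_injective ℂ (H →L[ℂ] H)) (by simpa using hρb)
    exact hb (by simp [hc])
  have hinv : ∀ g : Γ, ∀ a ∈ A, regularOf Γ g * a * star (regularOf Γ g) ∈ A := by
    intro g a ha
    obtain ⟨c, hc⟩ := (hmem a).1 ha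
    refine (hmem _).2 ⟨c, ?_⟩
    rw [map_mul, map_mul, ← hc, ← Algebra.commutes, mul_assoc, ← map_mul,
      Unitary.mul_star_self_of_mem (regularOf_mem_unitary g), map_one, mul_one]
  obtain ⟨φ, ⟨hφ1, hφpos⟩, ⟨ξ, η, hξ, hη, hsum⟩, hφinv⟩ :=
    hΓ.2 A hclosed hne hinv H (unitaryRep ρ) ρ fun g => rfl
  have hcomm : ∀ x : H →L[ℂ] H, x ∈ commutant (A.map ρ) := by
    intro x
    rw [commutant, StarSubalgebra.mem_centralizer_iff]
    rintro y hy
    obtain ⟨a, ha, rfl⟩ := hy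
    obtain ⟨c, hc⟩ := (hmem a).1 ha
    change ρ a * x = x * ρ a ∧ star (ρ a) * x = x * star (ρ a)
    rw [← hc, ← algebraMap_star_comm]
    exact ⟨Algebra.commutes _ _, Algebra.commutes _ _⟩
  exact exists_finiteDimensional_of_normal_invariant_state (unitaryRep ρ)
    (fun x => φ ⟨x, hcomm x⟩) hξ hη (fun x => hsum ⟨x, hcomm x⟩) hφ1
    (fun x => hφpos ⟨x, hcomm x⟩) (fun g x => hφinv g ⟨x, hcomm x⟩ _ rfl)

end RegularRepresentations

end NCJI

end

noncomputable section

namespace NCJI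

open scoped ENNReal ComplexOrder InnerProductSpace lp

universe u v

/-! ### Multiplication operators on `ℓ²(Γ)` -/

section MultiplicationOperators

variable {Γ : Type u}

theorem memℓp_mul_of_bounded {f : Γ → ℂ} {C : ℝ} (hf : ∀ h, ‖f h‖ ≤ C) (v : ℓ²(Γ, ℂ)) :
    Memℓp (fun h => f h * v h) 2 := by
  have h2 : 0 < (2 : ℝ≥0∞).toReal := by norm_num
  have hv := (memℓp_gen_iff h2).1 (lp.memℓp v)
  refine (memℓp_gen_iff h2).2 (Summable.of_nonneg_of_le (fun h => by positivity) (fun h => ?_)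
    (hv.mul_left (C ^ (2 : ℝ≥0∞).toReal)))
  rw [norm_mul, Real.mul_rpow (norm_nonneg _) (norm_nonneg _)]
  gcongr
  exact hf h

/-- Multiplication by a bounded function on `ℓ²(Γ)`. -/
def mulOp (f : Γ → ℂ) (C : ℝ) (hf : ∀ h, ‖f h‖ ≤ C) : ℓ²(Γ, ℂ) →L[ℂ] ℓ²(Γ, ℂ) :=
  LinearMap.mkContinuous
    { toFun := fun v => ⟨fun h => f h * v h, memℓp_mul_of_bounded hf v⟩
      map_add' := fun v w => by
        apply lp.ext; funext h
        exact mul_add _ _ _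
      map_smul' := fun c v => by
        apply lp.ext; funext h
        exact mul_left_comm _ _ _ } |C| fun v => by
    have h2 : 0 < (2 : ℝ≥0∞).toReal := by norm_num
    have hC : ‖|C| • v‖ = |C| * ‖v‖ := by rw [norm_smul, Real.norm_eq_abs, abs_abs]
    rw [← hC]
    refine lp.norm_mono (by norm_num) fun h => ?_
    change ‖f h * v h‖ ≤ ‖|C| • v h‖
    rw [norm_mul, norm_smul, Real.norm_eq_abs, abs_abs]
    gcongr
    exact (hf h).trans (le_abs_self C)

@[simp]
theorem mulOp_apply (f : Γ → ℂ) (C : ℝ) (hf : ∀ h, ‖f h‖ ≤ C) (v : ℓ²(Γ, ℂ)) (h : Γ) :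
    mulOp f C hf v h = f h * v h := rfl

theorem mulOp_nonneg (f : Γ → ℂ) (C : ℝ) (hf : ∀ h, ‖f h‖ ≤ C) (hpos : ∀ h, 0 ≤ f h) :
    0 ≤ mulOp f C hf := by
  rw [ContinuousLinearMap.nonneg_iff_isPositive, ContinuousLinearMap.isPositive_iff_complex]
  intro v
  have hsum := lp.hasSum_inner (𝕜 := ℂ) (mulOp f C hf v) v
  have hnn : ∀ h, 0 ≤ ⟪mulOp f C hf v h, v h⟫_ℂ := by
    intro h
    rw [mulOp_apply, RCLike.inner_apply, map_mul]
    have e : (starRingEnd ℂ) (f h) = f h :=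
      Complex.conj_eq_iff_im.2 (Complex.nonneg_iff.1 (hpos h)).2.symm
    rw [e, mul_left_comm, Complex.mul_conj]
    refine mul_nonneg (hpos h) ?_
    rw [Complex.zero_le_real]
    exact Complex.normSq_nonneg _
  have h0 : 0 ≤ ⟪mulOp f C hf v, v⟫_ℂ := hsum.nonneg hnn
  obtain ⟨hre, him⟩ := Complex.nonneg_iff.1 h0
  exact ⟨Complex.ext rfl (by simpa using him), hre⟩

theorem leftRegular_mul_mulOp [Group Γ] (g : Γ) (f f' : Γ → ℂ) (C C' : ℝ) (hf : ∀ h, ‖f h‖ ≤ C)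
    (hf' : ∀ h, ‖f' h‖ ≤ C') (hff : ∀ h, f' h = f (g⁻¹ * h)) :
    (leftRegular Γ g : ℓ²(Γ, ℂ) →L[ℂ] ℓ²(Γ, ℂ)) * mulOp f C hf =
      mulOp f' C' hf' * (leftRegular Γ g : ℓ²(Γ, ℂ) →L[ℂ] ℓ²(Γ, ℂ)) := by
  ext v h
  simp only [mul_apply_eq_comp, mulOp_apply, leftRegular_apply, hff]

end MultiplicationOperators

/-! ### From the trivial character to an invariant mean -/

section Characters

variable {Γ : Type u} [Group Γ]

theorem reducedCStar_clm_ext {E : Type*} [NormedAddCommGroup E] [NormedSpace ℂ E]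
    {S T : ReducedCStar Γ →L[ℂ] E} (h : ∀ g, S (regularOf Γ g) = T (regularOf Γ g)) : S = T := by
  refine ContinuousLinearMap.ext_on (s := Set.range (regularOf Γ))
    (fun x => mem_closure_span_regularOf x) ?_
  rintro _ ⟨g, rfl⟩
  exact h g

/-- The trivial representation extends to a contractive functional as soon as it is bounded. -/
theorem norm_le_one_of_apply_regularOf_eq_one (E : ReducedCStar Γ →L[ℂ] ℂ)
    (hE : ∀ g, E (regularOf Γ g) = 1) : ‖E‖ ≤ 1 := by
  have h1 : E 1 = 1 := by rw [← regularOf_one, hE]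
  have hleft : ∀ g y, E (regularOf Γ g * y) = E y := by
    intro g y
    have : E.comp (ContinuousLinearMap.mul ℂ (ReducedCStar Γ) (regularOf Γ g)) = E :=
      reducedCStar_clm_ext fun h => by
        change E (regularOf Γ g * regularOf Γ h) = _
        rw [← regularOf_mul, hE, hE]
    exact congrArg (fun F : ReducedCStar Γ →L[ℂ] ℂ => F y) this
  -- Multiplicativity passes from the group elements to all of `C*_λ(Γ)` by density, and characters
  -- of a Banach algebra are contractive.
  have hmul : ∀ x y, E (x * y) = E x * E y := by
    intro x y
    have : E.comp ((ContinuousLinearMap.mul ℂ (ReducedCStar Γ)).flip y) = E y • E :=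
      reducedCStar_clm_ext fun g => by
        change E (regularOf Γ g * y) = E y * E (regularOf Γ g)
        rw [hleft, hE, mul_one]
    have := congrArg (fun F : ReducedCStar Γ →L[ℂ] ℂ => F x) this
    exact this.trans (mul_comm _ _)
  have hn : Nontrivial (ReducedCStar Γ) := by
    refine ⟨⟨1, 0, fun h => ?_⟩⟩
    rw [h, map_zero] at h1
    exact zero_ne_one h1
  let χ : ReducedCStar Γ →ₐ[ℂ] ℂ := AlgHom.ofLinearMap E.toLinearMap h1 hmul
  refine E.opNorm_le_bound zero_le_one fun x => ?_
  rw [one_mul]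
  exact AlgHom.norm_apply_le_self χ x

/-- A norm-preserving extension `ψ` of `E` to `B(ℓ²(Γ))` is a state equal to `1` on each `λ(g)`,
hence insensitive to multiplication by `λ(g)` on either side. On multiplication operators, where `Ad
λ(g)` is translation, it is an invariant mean. -/
theorem isAmenable_of_functional (E : ReducedCStar Γ →L[ℂ] ℂ)
    (hE : ∀ g, E (regularOf Γ g) = 1) : IsAmenable Γ := by
  set B := ℓ²(Γ, ℂ) →L[ℂ] ℓ²(Γ, ℂ)
  obtain ⟨ψ, hψE, hψn⟩ := exists_extension_norm_eq
    (Subalgebra.toSubmodule (ReducedCStar Γ).toSubalgebra) E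
  have hψ1 : ‖ψ‖ ≤ 1 := hψn.trans_le (norm_le_one_of_apply_regularOf_eq_one E hE)
  have hψg : ∀ g : Γ, ψ (leftRegular Γ g : B) = 1 := fun g =>
    (hψE (regularOf Γ g)).trans (hE g)
  have hone : ψ 1 = 1 := by simpa using hψg 1
  let φ : B →ₚ[ℂ] ℂ := PositiveLinearMap.mk₀ ψ.toLinearMap
    fun x hx => apply_nonneg_of_norm_le_one ψ hψ1 hone hx
  have hφ : ∀ x, φ x = ψ x := fun _ => rfl
  have hstar : ∀ g : Γ, star (leftRegular Γ g : B) = (leftRegular Γ g⁻¹ : B) := by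
    intro g
    rw [map_inv, ← Unitary.star_eq_inv]; rfl
  have hmul : ∀ g h : Γ, (leftRegular Γ g : B) * (leftRegular Γ h : B) = leftRegular Γ (g * h) := by
    intro g h
    rw [map_mul]; rfl
  -- The vector of `1 - λ(g)` is null since `ψ` takes the value `1 - 1 - 1 + 1` on its square;
  -- Cauchy-Schwarz then gives invariance on both sides.
  have hnull : ∀ g : Γ, ‖φ.toPreGNS (1 - (leftRegular Γ g : B))‖ = 0 := by
    intro g
    rw [PositiveLinearMap.preGNS_norm_def, PositiveLinearMap.ofPreGNS_toPreGNS, hφ, star_sub,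
      star_one, hstar, mul_sub, sub_mul, sub_mul, hmul, one_mul, mul_one, inv_mul_cancel, map_sub,
      map_sub, map_sub]
    simp only [one_mul, hψg, hone, sub_self, Complex.zero_re, Real.sqrt_zero]
  have hright : ∀ (g : Γ) (y : B), ψ (y * (leftRegular Γ g : B)) = ψ y := by
    intro g y
    have h := norm_inner_le_norm (𝕜 := ℂ) (φ.toPreGNS (star y))
      (φ.toPreGNS (1 - (leftRegular Γ g : B)))
    rw [hnull, mul_zero, norm_le_zero_iff, PositiveLinearMap.preGNS_inner_def] at h
    simp only [PositiveLinearMap.ofPreGNS_toPreGNS, hφ, mul_sub, mul_one, map_sub] at h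
    have h' : ψ (star (star y) * (leftRegular Γ g : B)) = ψ (star (star y)) :=
      (sub_eq_zero.1 h).symm
    rwa [star_star] at h'
  have hleft : ∀ (g : Γ) (y : B), ψ ((leftRegular Γ g : B) * y) = ψ y := by
    intro g y
    have h := norm_inner_le_norm (𝕜 := ℂ) (φ.toPreGNS (1 - (leftRegular Γ g⁻¹ : B)))
      (φ.toPreGNS y)
    rw [hnull, zero_mul, norm_le_zero_iff, PositiveLinearMap.preGNS_inner_def] at h
    simp only [PositiveLinearMap.ofPreGNS_toPreGNS, star_sub, star_one, hstar, inv_inv, hφ, sub_mul,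
      one_mul, map_sub] at h
    exact (sub_eq_zero.1 h).symm
  have hbd : ∀ (f : ℓ^∞(Γ, ℝ)) (h : Γ), ‖((f h : ℝ) : ℂ)‖ ≤ ‖f‖ := fun f h => by
    rw [Complex.norm_real]
    exact lp.norm_apply_le_norm (by simp) f h
  let M : ℓ^∞(Γ, ℝ) → B := fun f => mulOp (fun h => ((f h : ℝ) : ℂ)) ‖f‖ (hbd f)
  refine ⟨{ toFun := fun f => (ψ (M f)).re, map_add' := ?_, map_smul' := ?_ }, ?_, ?_, ?_⟩
  · intro f f'
    have : M (f + f') = M f + M f' := by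
      ext v h
      simp [M, add_mul]
    rw [this, map_add, Complex.add_re]
  · intro c f
    have : M (c • f) = (c : ℂ) • M f := by
      ext v h
      change ((c * f h : ℝ) : ℂ) * v h = (c : ℂ) * (((f h : ℝ) : ℂ) * v h)
      push_cast
      ring
    rw [this, map_smul]
    simp
  · have : M 1 = 1 := by
      ext v h
      simp [M]
    change (ψ (M 1)).re = 1
    rw [this, hone, Complex.one_re]
  · intro f hf
    have := apply_nonneg_of_norm_le_one ψ hψ1 hone
      (mulOp_nonneg (fun h => ((f h : ℝ) : ℂ)) ‖f‖ (hbd f) fun h => by simpa using hf h)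
    exact (Complex.nonneg_iff.1 this).1
  · intro g f f' hff
    change (ψ (M f')).re = (ψ (M f)).re
    rw [← hright g (M f'), ← hleft g (M f)]
    congr 2
    exact (leftRegular_mul_mulOp g _ _ _ _ _ _ fun h => by rw [hff]).symm

end Characters

end NCJI

end

noncomputable section

namespace NCJI

open scoped ENNReal ComplexOrder InnerProductSpace lp

universe u v

/-! ### Finite-dimensional subrepresentations force amenability -/

section FiniteDimensionalRepresentations

variable {Γ : Type u} [Group Γ]
variable {H : Type u} [NormedAddCommGroup H] [InnerProductSpace ℂ H] [CompleteSpace H]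

/-- `Y` preserves the span of the `λ(g)`, hence by continuity `C*_λ(Γ)`, so it can be followed by
`ρ` and a matrix coefficient. -/
theorem exists_functional_of_multiplier (ρ : ReducedCStar Γ →⋆ₐ[ℂ] (H →L[ℂ] H))
    (Y : (ℓ²(Γ, ℂ) →L[ℂ] ℓ²(Γ, ℂ)) →L[ℂ] (ℓ²(Γ, ℂ) →L[ℂ] ℓ²(Γ, ℂ))) (c : Γ → ℂ)
    (hY : ∀ g, Y (leftRegular Γ g) = c g • (leftRegular Γ g : ℓ²(Γ, ℂ) →L[ℂ] ℓ²(Γ, ℂ)))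
    (e f : H) :
    ∃ F : ReducedCStar Γ →L[ℂ] ℂ, ∀ g, F (regularOf Γ g) = c g * ⟪e, ρ (regularOf Γ g) f⟫_ℂ := by
  have hspan : ∀ y ∈ Submodule.span ℂ (Set.range (regularOf Γ)),
      Y (y : ℓ²(Γ, ℂ) →L[ℂ] ℓ²(Γ, ℂ)) ∈ ReducedCStar Γ := by
    intro y hy
    induction hy using Submodule.span_induction with
    | mem y hy =>
      obtain ⟨g, rfl⟩ := hy
      change Y (leftRegular Γ g : ℓ²(Γ, ℂ) →L[ℂ] ℓ²(Γ, ℂ)) ∈ ReducedCStar Γ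
      rw [hY]
      exact (ReducedCStar Γ).smul_mem (rep_mem_groupCStar _ g) _
    | zero => simp
    | add y z _ _ hy hz =>
      rw [AddMemClass.coe_add, map_add]
      exact add_mem hy hz
    | smul c y _ hy =>
      change Y (c • (y : ℓ²(Γ, ℂ) →L[ℂ] ℓ²(Γ, ℂ))) ∈ ReducedCStar Γ
      rw [map_smul]
      exact (ReducedCStar Γ).smul_mem hy _
  have hYmem : ∀ x : ReducedCStar Γ, Y x ∈ ReducedCStar Γ := fun x =>
    closure_minimal (fun y hy => Set.mem_preimage.2 (hspan y hy))
      (isClosed_reducedCStar.preimage (Y.continuous.comp continuous_subtype_val))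
      (mem_closure_span_regularOf x)
  let R : ReducedCStar Γ →L[ℂ] (H →L[ℂ] H) := ⟨ρ.toAlgHom.toLinearMap, continuous_representation ρ⟩
  let Z : ReducedCStar Γ →L[ℂ] ReducedCStar Γ :=
    { toFun := fun x => ⟨Y x, hYmem x⟩
      map_add' := fun x y => Subtype.ext (map_add Y _ _)
      map_smul' := fun c x => Subtype.ext (map_smul Y _ _)
      cont := (Y.continuous.comp continuous_subtype_val).subtype_mk _ }
  refine ⟨(innerSL ℂ e).comp ((ContinuousLinearMap.apply ℂ H f).comp (R.comp Z)), fun g => ?_⟩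
  have hZ : Z (regularOf Γ g) = c g • regularOf Γ g := Subtype.ext (hY g)
  change ⟪e, ρ (Z (regularOf Γ g)) f⟫_ℂ = _
  rw [hZ, map_smul, smul_apply, inner_smul_right]

/-- A finite-dimensional representation weakly contained in `λ` forces amenability. -/
theorem isAmenable_of_finiteDimensional (ρ : ReducedCStar Γ →⋆ₐ[ℂ] (H →L[ℂ] H))
    (V : Submodule ℂ H) [FiniteDimensional ℂ V] (hV : V ≠ ⊥)
    (hinv : ∀ (g : Γ), ∀ v ∈ V, ρ (regularOf Γ g) v ∈ V) : IsAmenable Γ := by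
  obtain ⟨v₀, -, hv₀⟩ := (Submodule.ne_bot_iff V).1 hV
  have : Nontrivial H := ⟨⟨v₀, 0, hv₀⟩⟩
  set n := Module.finrank ℂ V with hn
  have hn0 : (n : ℂ) ≠ 0 := by
    have : n ≠ 0 := fun h => hV (Submodule.finrank_eq_zero.1 h)
    exact_mod_cast this
  let b := stdOrthonormalBasis ℂ V
  let u : Fin n → Fin n → Γ → ℂ := fun i j g => ⟪(b i : H), ρ (regularOf Γ g) (b j)⟫_ℂ
  have hone : ∀ i j, u i j 1 = if i = j then 1 else 0 := by
    intro i j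
    have := orthonormal_iff_ite.1 b.orthonormal i j
    simp only [u, regularOf_one, map_one]
    exact this
  have hmul : ∀ i j g h, u i j (g * h) = ∑ k, u i k g * u k j h := by
    intro i j g h
    have hx := b.sum_repr' ⟨ρ (regularOf Γ h) (b j), hinv h _ (b j).2⟩
    have hx' : ρ (regularOf Γ h) (b j) = ∑ k, u k j h • (b k : H) := by
      have := congrArg (Subtype.val : V → H) hx
      rw [Submodule.coe_sum] at this
      exact this.symm
    change ⟪(b i : H), ρ (regularOf Γ (g * h)) (b j)⟫_ℂ = _
    rw [regularOf_mul, map_mul, mul_apply_eq_comp, hx', map_sum, inner_sum]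
    refine Finset.sum_congr rfl fun k _ => ?_
    rw [map_smul, inner_smul_right, mul_comm]
  have hstar : ∀ i j g, (starRingEnd ℂ) (u i j g) = u j i g⁻¹ := by
    intro i j g
    simp only [u]
    rw [inner_conj_symm, ← star_regularOf, map_star, ContinuousLinearMap.star_eq_adjoint,
      ContinuousLinearMap.adjoint_inner_right]
  have hbd : ∀ i j g, ‖u i j g‖ ≤ 1 := by
    intro i j g
    have hnb : ∀ k, ‖(b k : H)‖ = 1 := fun k => b.orthonormal.1 k
    have hU : ‖ρ (regularOf Γ g) (b j)‖ ≤ 1 := by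
      refine (ContinuousLinearMap.le_opNorm _ _).trans ?_
      rw [hnb, mul_one]
      exact (CStarRing.norm_of_mem_unitary (Unitary.map_mem ρ (regularOf_mem_unitary g))).le
    refine (norm_inner_le_norm _ _).trans ?_
    rw [hnb, one_mul]
    exact hU
  have hbd' : ∀ i j g, ‖(starRingEnd ℂ) (u i j g)‖ ≤ 1 := fun i j g => by
    rw [RCLike.norm_conj]; exact hbd i j g
  -- The Schur multiplier of a matrix coefficient: `∑ₖ conj (u i k h) * u j k (g⁻¹ h)` depends on
  -- `g` only and equals `conj (u i j g)`.
  let Y : Fin n → Fin n → (ℓ²(Γ, ℂ) →L[ℂ] ℓ²(Γ, ℂ)) →L[ℂ] (ℓ²(Γ, ℂ) →L[ℂ] ℓ²(Γ, ℂ)) :=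
    fun i j => ∑ k, ContinuousLinearMap.mulLeftRight ℂ (ℓ²(Γ, ℂ) →L[ℂ] ℓ²(Γ, ℂ))
      (mulOp (fun h => (starRingEnd ℂ) (u i k h)) 1 (hbd' i k)) (mulOp (u j k) 1 (hbd j k))
  have hY : ∀ i j g, Y i j (leftRegular Γ g) =
      (starRingEnd ℂ) (u i j g) • (leftRegular Γ g : ℓ²(Γ, ℂ) →L[ℂ] ℓ²(Γ, ℂ)) := by
    intro i j g
    ext v h
    have e : Y i j (leftRegular Γ g) v h =
        ∑ k, (starRingEnd ℂ) (u i k h) * (u j k (g⁻¹ * h) * v (g⁻¹ * h)) := by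
      simp only [Y, sum_apply, lp.coeFn_sum, Finset.sum_apply]
      rfl
    rw [e, hstar]
    change _ = u j i g⁻¹ * v (g⁻¹ * h)
    have e2 := hmul j i (g⁻¹ * h) h⁻¹
    rw [mul_inv_cancel_right] at e2
    rw [e2, Finset.sum_mul]
    refine Finset.sum_congr rfl fun k _ => ?_
    rw [hstar]; ring
  choose F hF' using fun i j => exists_functional_of_multiplier ρ (Y i j)
    (fun g => (starRingEnd ℂ) (u i j g)) (hY i j) (b i : H) (b j : H)
  have hF : ∀ i j g, F i j (regularOf Γ g) = u i j g * u j i g⁻¹ := by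
    intro i j g
    rw [hF', hstar, mul_comm]
  -- `F i j` takes the value `|u i j g|²` at `λ(g)`, and the rows of a unitary matrix have norm one.
  refine isAmenable_of_functional ((n : ℂ)⁻¹ • ∑ i, ∑ j, F i j) fun g => ?_
  have hs : ∀ i, ∑ j, F i j (regularOf Γ g) = 1 := by
    intro i
    have := hmul i i g g⁻¹
    rw [mul_inv_cancel, hone, if_pos rfl] at this
    rw [this]
    exact Finset.sum_congr rfl fun j _ => hF i j g
  simp only [smul_apply, sum_apply, hs]
  simp [hn0]

theorem IsNCJustInfinite.isAmenable_or_isCStarSimple (hΓ : IsNCJustInfinite Γ) :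
    IsAmenable Γ ∨ IsCStarSimple Γ := by
  by_contra! h
  obtain ⟨hamen, hsimple⟩ := h
  rw [IsCStarSimple] at hsimple
  push Not at hsimple
  obtain ⟨I, -, hbot, htop⟩ := hsimple
  obtain ⟨b, hbI, hb⟩ : ∃ b ∈ I, b ≠ 0 := by
    by_contra! hall
    refine hbot (le_bot_iff.1 fun x hx => ?_)
    rw [hall x hx]
    exact TwoSidedIdeal.zero_mem _
  obtain ⟨H, _, _, _, _, ρ, hρ⟩ := exists_representation_of_ideal I htop
  obtain ⟨V, _, hV, hinv⟩ := hΓ.exists_finiteDimensional ρ hb (hρ b hbI)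
  exact hamen (isAmenable_of_finiteDimensional ρ V hV hinv)

end FiniteDimensionalRepresentations

end NCJI

end

noncomputable section

namespace NCJI

open scoped ENNReal ComplexOrder InnerProductSpace lp

universe u v

/-! ### Infinite conjugacy classes -/

section ICC

variable {Γ : Type u} [Group Γ]

open Classical in
theorem leftRegular_single (g h : Γ) :
    (leftRegular Γ g : ℓ²(Γ, ℂ) →L[ℂ] ℓ²(Γ, ℂ)) (lp.single 2 h (1 : ℂ)) =
      lp.single 2 (g * h) (1 : ℂ) := by
  apply lp.ext
  funext k
  rw [leftRegular_apply, lp.single_apply, lp.single_apply, Pi.single_apply, Pi.single_apply]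
  simp [inv_mul_eq_iff_eq_mul]

theorem star_leftRegular (g : Γ) : star (leftRegular Γ g : ℓ²(Γ, ℂ) →L[ℂ] ℓ²(Γ, ℂ)) =
    (leftRegular Γ g⁻¹ : ℓ²(Γ, ℂ) →L[ℂ] ℓ²(Γ, ℂ)) := by
  rw [map_inv, ← Unitary.star_eq_inv]
  rfl

theorem norm_leftRegular_apply (g : Γ) (v : ℓ²(Γ, ℂ)) :
    ‖(leftRegular Γ g : ℓ²(Γ, ℂ) →L[ℂ] ℓ²(Γ, ℂ)) v‖ = ‖v‖ :=
  (translate Γ g).norm_map v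

open Classical in
/-- The left regular representation of an infinite group has no nonzero finite-dimensional
subrepresentation. -/
theorem eq_bot_of_finiteDimensional_of_invariant [Infinite Γ] (V : Submodule ℂ ℓ²(Γ, ℂ))
    [FiniteDimensional ℂ V]
    (hinv : ∀ (g : Γ), ∀ v ∈ V, (leftRegular Γ g : ℓ²(Γ, ℂ) →L[ℂ] ℓ²(Γ, ℂ)) v ∈ V) : V = ⊥ := by
  let δ : Γ → ℓ²(Γ, ℂ) := fun h => lp.single 2 h (1 : ℂ)
  let P := V.starProjection
  have hPmem : ∀ x, P x ∈ V := fun x => Submodule.starProjection_apply_mem _ _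
  have hP : ∀ (h : Γ), P (δ h) = (leftRegular Γ h : ℓ²(Γ, ℂ) →L[ℂ] ℓ²(Γ, ℂ)) (P (δ 1)) := by
    intro h
    refine Submodule.eq_starProjection_of_mem_orthogonal (hinv h _ (hPmem _)) ?_
    have e : δ h = (leftRegular Γ h : ℓ²(Γ, ℂ) →L[ℂ] ℓ²(Γ, ℂ)) (δ 1) := by
      simp only [δ]
      rw [leftRegular_single, mul_one]
    rw [e, ← map_sub, Submodule.mem_orthogonal]
    intro v hv
    rw [← ContinuousLinearMap.adjoint_inner_left, ← ContinuousLinearMap.star_eq_adjoint,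
      star_leftRegular]
    exact (Submodule.mem_orthogonal _ _).1 (Submodule.sub_starProjection_mem_orthogonal (δ 1)) _
      (hinv h⁻¹ v hv)
  have hinner : ∀ v ∈ V, ∀ h, ⟪v, P (δ h)⟫_ℂ = (starRingEnd ℂ) (v h) := by
    intro v hv h
    have h0 := (Submodule.mem_orthogonal _ _).1 (Submodule.sub_starProjection_mem_orthogonal (δ h))
      v hv
    rw [inner_sub_right, sub_eq_zero] at h0
    rw [← h0, lp.inner_single_right, RCLike.inner_apply, one_mul]
  let b := stdOrthonormalBasis ℂ V
  -- Since `P` commutes with translations, the left side does not depend on `h`; the right side is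
  -- summable over the infinite group, so both vanish.
  have hnorm : ∀ h, ‖P (δ 1)‖ ^ 2 = ∑ i, ‖(b i : ℓ²(Γ, ℂ)) h‖ ^ 2 := by
    intro h
    have h1 := b.sum_sq_norm_inner_right ⟨P (δ h), hPmem _⟩
    have h2 : ‖(⟨P (δ h), hPmem _⟩ : V)‖ = ‖P (δ 1)‖ := by
      rw [Submodule.coe_norm, ← norm_leftRegular_apply h (P (δ 1)), ← hP]
    rw [← h2, ← h1]
    refine Finset.sum_congr rfl fun i _ => ?_
    rw [Submodule.coe_inner, hinner _ (b i).2, RCLike.norm_conj]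
  have hsum : Summable fun h : Γ => ∑ i, ‖(b i : ℓ²(Γ, ℂ)) h‖ ^ 2 := by
    refine summable_sum fun i _ => ?_
    have h2 : 0 < (2 : ℝ≥0∞).toReal := by norm_num
    have := (memℓp_gen_iff h2).1 (lp.memℓp (b i : ℓ²(Γ, ℂ)))
    simpa using this
  have hzero : ‖P (δ 1)‖ ^ 2 = 0 := by
    simp only [← hnorm] at hsum
    exact (summable_const_iff _).1 hsum
  have hPz : ∀ h, P (δ h) = 0 := by
    intro h
    rw [hP, norm_eq_zero.1 (pow_eq_zero_iff (two_ne_zero) |>.1 hzero), map_zero]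
  rw [Submodule.eq_bot_iff]
  intro v hv
  apply lp.ext
  funext h
  have := hinner v hv h
  rw [hPz, inner_zero_right] at this
  exact (map_eq_zero _).1 this.symm

/-- The restriction of `C*_λ(Γ)` to an invariant closed subspace of `ℓ²(Γ)`. -/
def restrictRep (K : Submodule ℂ ℓ²(Γ, ℂ)) [CompleteSpace K]
    (hK : ∀ (x : ReducedCStar Γ), ∀ v ∈ K, (x : ℓ²(Γ, ℂ) →L[ℂ] ℓ²(Γ, ℂ)) v ∈ K) :
    ReducedCStar Γ →⋆ₐ[ℂ] (K →L[ℂ] K) where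
  toFun x := (x : ℓ²(Γ, ℂ) →L[ℂ] ℓ²(Γ, ℂ)).restrict (hK x)
  map_one' := rfl
  map_mul' x y := rfl
  map_zero' := rfl
  map_add' x y := rfl
  commutes' c := rfl
  map_star' x := by
    rw [ContinuousLinearMap.star_eq_adjoint, ContinuousLinearMap.eq_adjoint_iff]
    intro v w
    change ⟪(star (x : ℓ²(Γ, ℂ) →L[ℂ] ℓ²(Γ, ℂ))) v, (w : ℓ²(Γ, ℂ))⟫_ℂ =
      ⟪(v : ℓ²(Γ, ℂ)), (x : ℓ²(Γ, ℂ) →L[ℂ] ℓ²(Γ, ℂ)) w⟫_ℂ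
    rw [ContinuousLinearMap.star_eq_adjoint, ContinuousLinearMap.adjoint_inner_left]

theorem apply_eq_zero_of_nonneg_of_inner_eq_zero {H : Type*} [NormedAddCommGroup H]
    [InnerProductSpace ℂ H] [CompleteSpace H] {b : H →L[ℂ] H} (hb : 0 ≤ b) {v : H}
    (hv : ⟪v, b v⟫_ℂ = 0) : b v = 0 := by
  obtain ⟨s, rfl⟩ := CStarAlgebra.nonneg_iff_eq_star_mul_self.1 hb
  rw [mul_apply_eq_comp, ContinuousLinearMap.star_eq_adjoint,
    ContinuousLinearMap.adjoint_inner_right, inner_self_eq_zero] at hv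
  rw [mul_apply_eq_comp, hv, map_zero]

/-- A self-adjoint operator `b` with `b v ≠ 0` and `⟪v, b v⟫ = 0` for some `v` has nonzero positive
and negative parts. -/
theorem exists_mul_eq_zero_of_isSelfAdjoint {H : Type*} [NormedAddCommGroup H]
    [InnerProductSpace ℂ H] [CompleteSpace H] (S : StarSubalgebra ℂ (H →L[ℂ] H))
    [IsClosed (S : Set (H →L[ℂ] H))] {b : H →L[ℂ] H} (hbS : b ∈ S) (hb : IsSelfAdjoint b) {v : H}
    (hv : ⟪v, b v⟫_ℂ = 0) (hv' : b v ≠ 0) :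
    ∃ c d : H →L[ℂ] H, c ∈ S ∧ (∀ y, Commute b y → Commute c y) ∧ c * d = 0 ∧ c ≠ 0 ∧ d ≠ 0 := by
  -- If one of the parts vanished, `b` or `-b` would be positive, and `⟪v, b v⟫ = 0` would force `b
  -- v = 0`.
  refine ⟨b⁻, b⁺, ?_, fun y hy => ?_, CFC.negPart_mul_posPart b, fun h => hv' ?_, fun h => hv' ?_⟩
  · rw [CFC.negPart_def]
    exact cfcₙ_mem (𝕜' := ℂ) _ hbS
  · rw [CFC.negPart_def]
    exact hy.cfcₙ_real _
  · exact apply_eq_zero_of_nonneg_of_inner_eq_zero ((CFC.negPart_eq_zero_iff b hb).1 h) hv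
  · have h0 := (CFC.posPart_eq_zero_iff b hb).1 h
    have := apply_eq_zero_of_nonneg_of_inner_eq_zero (b := -b) (v := v) (neg_nonneg.2 h0)
      (by rw [neg_apply, inner_neg_right, hv, neg_zero])
    rwa [neg_apply, neg_eq_zero] at this

/-- In an nc-just-infinite group, the elements of `C*_λ(Γ)` that commute with `Γ` are not zero
divisors in `B(ℓ²(Γ))`. -/
theorem IsNCJustInfinite.eq_zero_or_eq_zero_of_mul_eq_zero (hΓ : IsNCJustInfinite Γ)
    (c d : ℓ²(Γ, ℂ) →L[ℂ] ℓ²(Γ, ℂ)) (hmem : c ∈ ReducedCStar Γ)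
    (hcomm : ∀ g : Γ, Commute c (leftRegular Γ g : ℓ²(Γ, ℂ) →L[ℂ] ℓ²(Γ, ℂ))) (hcd : c * d = 0) :
    c = 0 ∨ d = 0 := by
  by_contra! hne
  have := hΓ.1
  have hcomm' : ∀ x : ReducedCStar Γ, Commute c (x : ℓ²(Γ, ℂ) →L[ℂ] ℓ²(Γ, ℂ)) := by
    intro x
    have e : ContinuousLinearMap.mul ℂ (ReducedCStar Γ) ⟨c, hmem⟩ =
        (ContinuousLinearMap.mul ℂ (ReducedCStar Γ)).flip ⟨c, hmem⟩ :=
      reducedCStar_clm_ext fun g => Subtype.ext (hcomm g)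
    exact congrArg Subtype.val
      (congrArg (fun F : ReducedCStar Γ →L[ℂ] ReducedCStar Γ => F x) e)
  -- The kernel is invariant because `c` commutes with `C*_λ(Γ)`, and nonzero because it contains
  -- the range of `d`. Restriction to it kills `c`.
  let K : Submodule ℂ ℓ²(Γ, ℂ) := LinearMap.ker c.toLinearMap
  have hKmem : ∀ v, v ∈ K ↔ c v = 0 := fun v => Iff.rfl
  have hKc : CompleteSpace K := (ContinuousLinearMap.isClosed_ker c).completeSpace_coe
  have hKinv : ∀ (x : ReducedCStar Γ), ∀ v ∈ K, (x : ℓ²(Γ, ℂ) →L[ℂ] ℓ²(Γ, ℂ)) v ∈ K := by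
    intro x v hv
    rw [hKmem] at hv ⊢
    rw [← mul_apply_eq_comp, (hcomm' x).eq, mul_apply_eq_comp, hv, map_zero]
  have hKn : Nontrivial K := by
    obtain ⟨v, hv⟩ : ∃ v, d v ≠ 0 := by
      by_contra! h
      exact hne.2 (ContinuousLinearMap.ext h)
    refine ⟨⟨⟨d v, ?_⟩, 0, fun h => hv (congrArg Subtype.val h)⟩⟩
    rw [hKmem, ← mul_apply_eq_comp, hcd]
    rfl
  have hker : restrictRep K hKinv ⟨c, hmem⟩ = 0 :=
    ContinuousLinearMap.ext fun v => Subtype.ext v.2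
  obtain ⟨V, _, hV, hVinv⟩ := hΓ.exists_finiteDimensional (restrictRep K hKinv)
    (b := ⟨c, hmem⟩) (fun h => hne.1 (congrArg Subtype.val h)) hker
  have hbot : V.map K.subtype = ⊥ := by
    refine eq_bot_of_finiteDimensional_of_invariant _ ?_
    rintro g _ ⟨v, hv, rfl⟩
    exact ⟨_, hVinv g v hv, rfl⟩
  rw [Submodule.eq_bot_iff] at hbot
  refine hV ((Submodule.eq_bot_iff V).2 fun v hv => Subtype.ext ?_)
  exact hbot _ ⟨v, hv, rfl⟩

open Classical in
theorem IsNCJustInfinite.isICC (hΓ : IsNCJustInfinite Γ) : IsICC Γ := by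
  intro g hg hinf
  have hfin : (conjugatesOf g).Finite := by simpa using hinf
  let L : Γ → (ℓ²(Γ, ℂ) →L[ℂ] ℓ²(Γ, ℂ)) := fun h => (leftRegular Γ h : _ →L[ℂ] _)
  have hLmul : ∀ x y, L x * L y = L (x * y) := fun x y => by simp [L]
  let C : Finset Γ := hfin.toFinset
  have hC : ∀ x, x ∈ C ↔ IsConj g x := fun x => hfin.mem_toFinset
  -- Adding the inverses makes the class sum self-adjoint. Its coefficients stay nonnegative, so
  -- nothing cancels at `g`.
  let b : ℓ²(Γ, ℂ) →L[ℂ] ℓ²(Γ, ℂ) := ∑ h ∈ C, (L h + L h⁻¹)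
  have hb : IsSelfAdjoint b := by
    rw [isSelfAdjoint_iff, star_sum]
    refine Finset.sum_congr rfl fun h _ => ?_
    rw [star_add, star_leftRegular, star_leftRegular, inv_inv, add_comm]
  have hmem : b ∈ ReducedCStar Γ := sum_mem fun h _ =>
    add_mem (rep_mem_groupCStar _ _) (rep_mem_groupCStar _ _)
  have hcomm : ∀ k : Γ, Commute b (L k) := by
    intro k
    rw [commute_iff_eq, Finset.sum_mul, Finset.mul_sum]
    refine Finset.sum_bij' (fun h _ => k⁻¹ * h * k) (fun h _ => k * h * k⁻¹) ?_ ?_ ?_ ?_ ?_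
    · intro h hh
      rw [hC] at hh ⊢
      exact hh.trans (isConj_iff.2 ⟨k⁻¹, by group⟩)
    · intro h hh
      rw [hC] at hh ⊢
      exact hh.trans (isConj_iff.2 ⟨k, rfl⟩)
    · intro h _; group
    · intro h _; group
    · intro h _
      rw [add_mul, mul_add, hLmul, hLmul, hLmul, hLmul]
      congr 2 <;> group
  let δ : Γ → ℓ²(Γ, ℂ) := fun h => lp.single 2 h (1 : ℂ)
  have hδ : ∀ x y, (δ x : Γ → ℂ) y = if y = x then 1 else 0 := fun x y => by
    simp only [δ, lp.single_apply, Pi.single_apply]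
  have hbδ : ∀ y, (b (δ 1) : Γ → ℂ) y =
      ∑ h ∈ C, ((if y = h then 1 else 0) + (if y = h⁻¹ then 1 else 0) : ℂ) := by
    intro y
    have e : b (δ 1) = ∑ h ∈ C, (δ h + δ h⁻¹) := by
      simp only [b, sum_apply, add_apply]
      refine Finset.sum_congr rfl fun h _ => ?_
      simp only [L, δ, leftRegular_single, mul_one]
    rw [e, lp.coeFn_sum, Finset.sum_apply]
    refine Finset.sum_congr rfl fun h _ => ?_
    rw [lp.coeFn_add, Pi.add_apply, hδ, hδ]
  have hne1 : ∀ h ∈ C, h ≠ 1 := by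
    rintro h hh rfl
    exact hg (isConj_one_left.1 ((hC 1).1 hh))
  have hv : ⟪δ 1, b (δ 1)⟫_ℂ = 0 := by
    rw [lp.inner_single_left, hbδ]
    rw [Finset.sum_eq_zero, inner_zero_right]
    intro h hh
    have h1 := hne1 h hh
    rw [if_neg h1.symm, if_neg (fun e => h1 (inv_eq_one.1 e.symm)), add_zero]
  have hv' : b (δ 1) ≠ 0 := by
    intro h0
    have h1 := hbδ g
    rw [h0, lp.coeFn_zero, Pi.zero_apply] at h1
    have h2 : (∑ h ∈ C, ((if g = h then 1 else 0) + (if g = h⁻¹ then 1 else 0) : ℝ)) = 0 := by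
      have := congrArg Complex.re h1
      rw [Complex.zero_re, Complex.re_sum] at this
      refine Eq.trans ?_ this.symm
      refine Finset.sum_congr rfl fun h _ => ?_
      split_ifs <;> simp
    rw [Finset.sum_eq_zero_iff_of_nonneg (fun h _ => by split_ifs <;> norm_num)] at h2
    have := h2 g ((hC g).2 (IsConj.refl g))
    rw [if_pos rfl] at this
    split_ifs at this <;> norm_num at this
  obtain ⟨c, d, hcmem, hcc, hcd, hc0, hd0⟩ :=
    exists_mul_eq_zero_of_isSelfAdjoint (ReducedCStar Γ) hmem hb hv hv'
  rcases hΓ.eq_zero_or_eq_zero_of_mul_eq_zero c d hcmem (fun k => hcc _ (hcomm k)) hcd with h | h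
  · exact hc0 h
  · exact hd0 h

end ICC

end NCJI

end

noncomputable section

namespace NCJI

open scoped ENNReal ComplexOrder InnerProductSpace lp

universe u v

/-! ### Simplicity from half-space systems -/

section HalfSpaces

open scoped Pointwise

/-- A system of half-spaces for a faithful action of `G` on `X`: a `G`-invariant nested family of
subsets closed under complements, on which the action is sufficiently proximal and
micro-supported. -/
structure IsHalfSpaceSystem (G : Type*) [Group G] {X : Type*} [MulAction G X]
    (𝓗 : Set (Set X)) : Prop where
  smul_mem : ∀ (g : G), ∀ H ∈ 𝓗, g • H ∈ 𝓗
  compl_mem : ∀ H ∈ 𝓗, Hᶜ ∈ 𝓗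
  nested : ∀ H ∈ 𝓗, ∀ K ∈ 𝓗, H ⊆ K ∨ H ⊆ Kᶜ ∨ Hᶜ ⊆ K ∨ Hᶜ ⊆ Kᶜ
  exists_disjoint_smul : ∀ g : G, g ≠ 1 → ∃ H ∈ 𝓗, Disjoint (g • H) H
  exists_smul_subset : ∀ H ∈ 𝓗, ∀ K ∈ 𝓗, ∃ g : G, g • H ⊆ K
  exists_mem_fixingSubgroup : ∃ H ∈ 𝓗, ∃ g ∈ fixingSubgroup G Hᶜ, g ≠ 1

variable {G : Type*} [Group G] {X : Type*} [MulAction G X] {𝓗 : Set (Set X)}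

theorem conj_mem_fixingSubgroup_compl {H : Set X} {a : G} (ha : a ∈ fixingSubgroup G Hᶜ) (g : G) :
    g * a * g⁻¹ ∈ fixingSubgroup G (g • H)ᶜ := by
  rw [mem_fixingSubgroup_iff] at ha ⊢
  intro x hx
  have h1 : g⁻¹ • x ∈ Hᶜ := fun h => hx (Set.mem_smul_set_iff_inv_smul_mem.2 h)
  rw [mul_smul, mul_smul, ha _ h1, smul_inv_smul]

theorem fixingSubgroup_compl_mono {H K : Set X} (h : H ⊆ K) {a : G}
    (ha : a ∈ fixingSubgroup G Hᶜ) : a ∈ fixingSubgroup G Kᶜ := by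
  rw [mem_fixingSubgroup_iff] at ha ⊢
  exact fun x hx => ha x fun hxH => hx (h hxH)

theorem commute_of_mem_fixingSubgroup_compl [FaithfulSMul G X] {H K : Set X} (h : Disjoint H K)
    {a b : G} (ha : a ∈ fixingSubgroup G Hᶜ) (hb : b ∈ fixingSubgroup G Kᶜ) : Commute a b := by
  rw [mem_fixingSubgroup_iff] at ha hb
  have hd : (MulAction.toPerm a : Equiv.Perm X).Disjoint (MulAction.toPerm b) := by
    intro x
    by_cases hx : x ∈ H
    · exact Or.inr (hb x (Set.disjoint_left.1 h hx))
    · exact Or.inl (ha x hx)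
  refine MulAction.toPerm_injective (β := X) ?_
  have := hd.commute.eq
  ext x
  have hx := congrArg (fun f : Equiv.Perm X => f x) this
  simpa only [MulAction.toPerm_apply, mul_smul, Equiv.Perm.mul_apply] using hx

/-- Every half-space can be moved off itself by an element of `N`. -/
def Displaces (N : Subgroup G) (𝓗 : Set (Set X)) : Prop :=
  ∀ H ∈ 𝓗, ∃ n ∈ N, Disjoint (n • H) H

/-- Every half-space can be moved into every other one by an element of `M`. -/
def Compresses (M : Subgroup G) (𝓗 : Set (Set X)) : Prop :=
  ∀ H ∈ 𝓗, ∀ K ∈ 𝓗, ∃ m ∈ M, m • H ⊆ K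

namespace IsHalfSpaceSystem

theorem compresses_top (h𝓗 : IsHalfSpaceSystem G 𝓗) : Compresses (⊤ : Subgroup G) 𝓗 :=
  fun H hH K hK => (h𝓗.exists_smul_subset H hH K hK).imp fun _ hg => ⟨Subgroup.mem_top _, hg⟩

/-- A nontrivial `n ∈ N` displaces some half-space `K`; if `m ∈ M` moves `H` into `K`, then `m⁻¹ n m
∈ N` displaces `H`. -/
theorem displaces (h𝓗 : IsHalfSpaceSystem G 𝓗) {M N : Subgroup G} (hM : Compresses M 𝓗)
    (hN : N ≠ ⊥) (hMN : ∀ m ∈ M, ∀ n ∈ N, m * n * m⁻¹ ∈ N) : Displaces N 𝓗 := by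
  intro H hH
  obtain ⟨⟨n, hn⟩, hne⟩ := Subgroup.ne_bot_iff_exists_ne_one.1 hN
  have hn1 : n ≠ 1 := fun h => hne (Subtype.ext h)
  obtain ⟨K, hK, hdisj⟩ := h𝓗.exists_disjoint_smul n hn1
  obtain ⟨m, hm, hmH⟩ := hM H hH K hK
  refine ⟨m⁻¹ * n * m, by simpa using hMN m⁻¹ (inv_mem hm) n hn, ?_⟩
  have h1 : (m⁻¹ * n * m) • H ⊆ m⁻¹ • (n • K) := by
    rw [mul_smul, mul_smul]
    exact Set.smul_set_mono (Set.smul_set_mono hmH)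
  have h2 : H ⊆ m⁻¹ • K := by
    rw [Set.subset_smul_set_iff, inv_inv]
    exact hmH
  refine Disjoint.mono h1 h2 ?_
  rw [Set.disjoint_smul_set]
  exact hdisj

/-- Displacing `H` moves it into `Hᶜ`, and displacing `Kᶜ` moves it into `K`; in each nested
position one, both or neither of these moves brings `H` into `K`. -/
theorem compresses (h𝓗 : IsHalfSpaceSystem G 𝓗) {M : Subgroup G} (hM : Displaces M 𝓗) :
    Compresses M 𝓗 := by
  intro H hH K hK
  obtain ⟨n, hn, hnH⟩ := hM H hH
  obtain ⟨k, hk, hkK⟩ := hM Kᶜ (h𝓗.compl_mem K hK)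
  have hn' : n • H ⊆ Hᶜ := Set.disjoint_left.1 hnH
  have hk' : k • Kᶜ ⊆ K := by
    have := Set.disjoint_left.1 hkK
    intro x hx
    by_contra hxK
    exact this hx hxK
  rcases h𝓗.nested H hH K hK with h | h | h | h
  · exact ⟨1, one_mem _, by rwa [one_smul]⟩
  · exact ⟨k, hk, (Set.smul_set_mono h).trans hk'⟩
  · exact ⟨n, hn, hn'.trans h⟩
  · refine ⟨k * n, mul_mem hk hn, ?_⟩
    rw [mul_smul]
    exact (Set.smul_set_mono (hn'.trans h)).trans hk'

/-- The double commutator trick: if `n ∈ N` displaces `H`, then `c = [a, n]` is in `N`, and `[c, b]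
= [a, b]` because `n a⁻¹ n⁻¹` is supported off `H` and commutes with `b`. -/
theorem commutator_mem [FaithfulSMul G X] {M N : Subgroup G} (hN : Displaces N 𝓗)
    (hMN : ∀ m ∈ M, ∀ n ∈ N, m * n * m⁻¹ ∈ N) {H : Set X} (hH : H ∈ 𝓗) {a b : G}
    (haM : a ∈ M) (ha : a ∈ fixingSubgroup G Hᶜ) (hbM : b ∈ M) (hb : b ∈ fixingSubgroup G Hᶜ) :
    a * b * a⁻¹ * b⁻¹ ∈ N := by
  obtain ⟨n, hn, hdisj⟩ := hN H hH
  have hcomm : Commute (n * a⁻¹ * n⁻¹) b :=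
    commute_of_mem_fixingSubgroup_compl hdisj (conj_mem_fixingSubgroup_compl (inv_mem ha) n) hb
  have hc : a * (n * a⁻¹ * n⁻¹) ∈ N := by
    have := mul_mem (hMN a haM n hn) (inv_mem hn)
    convert this using 1
    group
  have hcb : a * (n * a⁻¹ * n⁻¹) * (b * (a * (n * a⁻¹ * n⁻¹))⁻¹ * b⁻¹) ∈ N :=
    mul_mem hc (hMN b hbM _ (inv_mem hc))
  have e : a * (n * a⁻¹ * n⁻¹) * (b * (a * (n * a⁻¹ * n⁻¹))⁻¹ * b⁻¹) =
      a * ((n * a⁻¹ * n⁻¹) * b * (n * a⁻¹ * n⁻¹)⁻¹) * a⁻¹ * b⁻¹ := by group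
  rwa [e, hcomm.eq, mul_inv_cancel_right] at hcb

theorem exists_ne_one_mem_fixingSubgroup (h𝓗 : IsHalfSpaceSystem G 𝓗) {K : Set X} (hK : K ∈ 𝓗) :
    ∃ g ∈ fixingSubgroup G Kᶜ, g ≠ 1 := by
  obtain ⟨H, hH, g, hg, hg1⟩ := h𝓗.exists_mem_fixingSubgroup
  obtain ⟨k, hk⟩ := h𝓗.exists_smul_subset H hH K hK
  exact ⟨k * g * k⁻¹, fixingSubgroup_compl_mono hk (conj_mem_fixingSubgroup_compl hg k),
    fun h => hg1 (conj_eq_one_iff.1 h)⟩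

/-- Take `a` supported in `H`, a half-space `K` displaced by `a`, and `b` supported in `K`. If they
commuted, `b` would be supported in both `K` and `a • K`, which are disjoint. -/
theorem exists_commutator_ne_one [FaithfulSMul G X] (h𝓗 : IsHalfSpaceSystem G 𝓗) {M : Subgroup G}
    (hM : ∀ H ∈ 𝓗, ∃ g ∈ M, g ∈ fixingSubgroup G Hᶜ ∧ g ≠ 1) {H : Set X} (hH : H ∈ 𝓗) :
    ∃ a ∈ M, a ∈ fixingSubgroup G Hᶜ ∧ ∃ b ∈ M, b ∈ fixingSubgroup G Hᶜ ∧
      a * b * a⁻¹ * b⁻¹ ≠ 1 := by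
  obtain ⟨a, haM, ha, ha1⟩ := hM H hH
  obtain ⟨K, hK, hdisj⟩ := h𝓗.exists_disjoint_smul a ha1
  obtain ⟨b, hbM, hb, hb1⟩ := hM K hK
  have hKH : K ⊆ H := by
    intro x hx
    by_contra hxH
    have hax : a • x = x := (mem_fixingSubgroup_iff G).1 ha x hxH
    exact Set.disjoint_left.1 hdisj (hax ▸ Set.smul_mem_smul_set hx) hx
  refine ⟨a, haM, ha, b, hbM, fixingSubgroup_compl_mono hKH hb, fun h => hb1 ?_⟩
  have e : a * b * a⁻¹ = b := mul_inv_eq_one.1 h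
  have hb' : b ∈ fixingSubgroup G (a • K)ᶜ := by
    have := conj_mem_fixingSubgroup_compl hb a
    rwa [e] at this
  refine eq_of_smul_eq_smul (α := X) fun x => ?_
  rw [one_smul]
  by_cases hx : x ∈ K
  · exact (mem_fixingSubgroup_iff G).1 hb' x fun h' => Set.disjoint_left.1 hdisj h' hx
  · exact (mem_fixingSubgroup_iff G).1 hb x hx

end IsHalfSpaceSystem

/-- The intersection of all nontrivial normal subgroups of `G`. -/
def monolith (G : Type*) [Group G] : Subgroup G := sInf {N : Subgroup G | N.Normal ∧ N ≠ ⊥}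

theorem monolith_le {N : Subgroup G} (hN : N.Normal) (hN' : N ≠ ⊥) : monolith G ≤ N :=
  sInf_le ⟨hN, hN'⟩

theorem conj_mem_monolith {m : G} (hm : m ∈ monolith G) (g : G) : g * m * g⁻¹ ∈ monolith G := by
  rw [monolith, Subgroup.mem_sInf] at hm ⊢
  exact fun N hN => hN.1.conj_mem m (hm N hN) g

namespace IsHalfSpaceSystem

variable [FaithfulSMul G X]

theorem exists_mem_monolith (h𝓗 : IsHalfSpaceSystem G 𝓗) {H : Set X} (hH : H ∈ 𝓗) :
    ∃ g ∈ monolith G, g ∈ fixingSubgroup G Hᶜ ∧ g ≠ 1 := by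
  obtain ⟨a, -, ha, b, -, hb, hab⟩ := h𝓗.exists_commutator_ne_one (M := ⊤)
    (fun K hK => (h𝓗.exists_ne_one_mem_fixingSubgroup hK).imp fun g hg =>
      ⟨Subgroup.mem_top g, hg⟩) hH
  refine ⟨a * b * a⁻¹ * b⁻¹, ?_, mul_mem (mul_mem (mul_mem ha hb) (inv_mem ha)) (inv_mem hb), hab⟩
  rw [monolith, Subgroup.mem_sInf]
  rintro N ⟨hN, hN'⟩
  have hconj : ∀ m ∈ (⊤ : Subgroup G), ∀ n ∈ N, m * n * m⁻¹ ∈ N :=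
    fun m _ n hn => hN.conj_mem n hn m
  exact commutator_mem (h𝓗.displaces h𝓗.compresses_top hN' hconj) hconj hH
    (Subgroup.mem_top a) ha (Subgroup.mem_top b) hb

theorem monolith_ne_bot (h𝓗 : IsHalfSpaceSystem G 𝓗) : monolith G ≠ ⊥ := by
  obtain ⟨H, hH, -⟩ := h𝓗.exists_mem_fixingSubgroup
  obtain ⟨g, hg, -, hg1⟩ := h𝓗.exists_mem_monolith hH
  intro h
  rw [h, Subgroup.mem_bot] at hg
  exact hg1 hg

theorem compresses_monolith (h𝓗 : IsHalfSpaceSystem G 𝓗) : Compresses (monolith G) 𝓗 :=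
  h𝓗.compresses (h𝓗.displaces h𝓗.compresses_top h𝓗.monolith_ne_bot
    fun m _ _ hn => conj_mem_monolith hn m)

theorem isSimpleGroup_monolith (h𝓗 : IsHalfSpaceSystem G 𝓗) : IsSimpleGroup (monolith G) := by
  have hnt : Nontrivial (monolith G) := (Subgroup.nontrivial_iff_ne_bot _).2 h𝓗.monolith_ne_bot
  refine ⟨fun N hN => ?_⟩
  by_cases hbot : N = ⊥
  · exact Or.inl hbot
  refine Or.inr ?_
  set N' : Subgroup G := N.map (monolith G).subtype with hN'
  have hN'bot : N' ≠ ⊥ := fun h =>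
    hbot ((Subgroup.map_eq_bot_iff_of_injective N (monolith G).subtype_injective).1 h)
  have hconj : ∀ m ∈ monolith G, ∀ n ∈ N', m * n * m⁻¹ ∈ N' := by
    rintro m hm _ ⟨n, hn, rfl⟩
    exact ⟨⟨m, hm⟩ * n * ⟨m, hm⟩⁻¹, hN.conj_mem n hn _, rfl⟩
  have hdisp : Displaces N' 𝓗 := h𝓗.displaces h𝓗.compresses_monolith hN'bot hconj
  -- `N'` is only known to be normalized by the monolith, but every `G`-conjugate of an element of
  -- `S` is a commutator of the same kind. Hence `N'` contains a nontrivial normal subgroup of `G`,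
  -- and so the monolith.
  let S : Set G := {g | ∃ H ∈ 𝓗, ∃ a ∈ monolith G, a ∈ fixingSubgroup G Hᶜ ∧
    ∃ b ∈ monolith G, b ∈ fixingSubgroup G Hᶜ ∧ a * b * a⁻¹ * b⁻¹ = g}
  have hle : Subgroup.normalClosure S ≤ N' := by
    rw [Subgroup.normalClosure, Subgroup.closure_le]
    intro x hx
    obtain ⟨s, ⟨H, hH, a, haM, ha, b, hbM, hb, rfl⟩, hsx⟩ := Group.mem_conjugatesOfSet_iff.1 hx
    obtain ⟨g, rfl⟩ := isConj_iff.1 hsx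
    have := commutator_mem hdisp hconj (h𝓗.smul_mem g H hH) (conj_mem_monolith haM g)
      (conj_mem_fixingSubgroup_compl ha g) (conj_mem_monolith hbM g)
      (conj_mem_fixingSubgroup_compl hb g)
    have e : g * (a * b * a⁻¹ * b⁻¹) * g⁻¹ = g * a * g⁻¹ * (g * b * g⁻¹) * (g * a * g⁻¹)⁻¹ *
        (g * b * g⁻¹)⁻¹ := by group
    rw [e]
    exact this
  have hne : Subgroup.normalClosure S ≠ ⊥ := by
    obtain ⟨H, hH, -⟩ := h𝓗.exists_mem_fixingSubgroup
    obtain ⟨a, haM, ha, b, hbM, hb, hab⟩ := h𝓗.exists_commutator_ne_one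
      (fun K hK => h𝓗.exists_mem_monolith hK) hH
    intro h
    have hmem : a * b * a⁻¹ * b⁻¹ ∈ Subgroup.normalClosure S :=
      Subgroup.subset_normalClosure ⟨H, hH, a, haM, ha, b, hbM, hb, rfl⟩
    rw [h, Subgroup.mem_bot] at hmem
    exact hab hmem
  have hM : monolith G ≤ N' := (monolith_le Subgroup.normalClosure_normal hne).trans hle
  refine (Subgroup.eq_top_iff' N).2 fun m => ?_
  obtain ⟨n, hn, hnm⟩ := hM m.2
  rwa [← Subtype.ext hnm]

end IsHalfSpaceSystem

end HalfSpaces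

/-! ### Compression excludes invariant means -/

section Amenability

open scoped Pointwise

variable {Γ : Type u} [Group Γ]

theorem isAmenable_of_finite [Finite Γ] : IsAmenable Γ := by
  have := Fintype.ofFinite Γ
  have hc : (Fintype.card Γ : ℝ) ≠ 0 := by exact_mod_cast Fintype.card_ne_zero
  refine ⟨{ toFun := fun f => (Fintype.card Γ : ℝ)⁻¹ * ∑ h, (f : Γ → ℝ) h, map_add' := ?_, map_smul' := ?_ },
    ?_, ?_, ?_⟩
  · intro f f'
    rw [← mul_add, ← Finset.sum_add_distrib]
    rfl
  · intro c f
    simp [← Finset.mul_sum, mul_left_comm]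
  · change (Fintype.card Γ : ℝ)⁻¹ * ∑ h : Γ, (1 : ℓ^∞(Γ, ℝ)) h = 1
    simp [hc]
  · intro f hf
    exact mul_nonneg (by positivity) (Finset.sum_nonneg fun h _ => hf h)
  · intro g f f' hff
    change (Fintype.card Γ : ℝ)⁻¹ * ∑ h, (f' : Γ → ℝ) h =
      (Fintype.card Γ : ℝ)⁻¹ * ∑ h, (f : Γ → ℝ) h
    simp only [hff]
    congr 1
    exact Equiv.sum_comp (Equiv.mulLeft g⁻¹) (f : Γ → ℝ)

open Classical in
/-- A group acting with enough compression on a complemented family of sets that contains three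
pairwise disjoint members is not amenable. -/
theorem not_isAmenable_of_compression {X : Type*} [MulAction Γ X] (x₀ : X) {𝓗 : Set (Set X)}
    (hcompr : ∀ H ∈ 𝓗, ∀ K ∈ 𝓗, ∃ g : Γ, g • H ⊆ K) (hcompl : ∀ H ∈ 𝓗, Hᶜ ∈ 𝓗)
    {H₁ H₂ H₃ : Set X} (h₁ : H₁ ∈ 𝓗) (h₂ : H₂ ∈ 𝓗) (h₃ : H₃ ∈ 𝓗) (h₁₂ : Disjoint H₁ H₂)
    (h₁₃ : Disjoint H₁ H₃) (h₂₃ : Disjoint H₂ H₃) : ¬ IsAmenable Γ := by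
  rintro ⟨m, hm1, hmpos, hminv⟩
  -- The mean is transported to `X` along the orbit map of `x₀`. Compression gives all members of
  -- `𝓗` the same measure, which is `1/2` by complements, so three cannot be disjoint.
  let ind : Set X → ℓ^∞(Γ, ℝ) := fun S => ⟨fun g => if g • x₀ ∈ S then 1 else 0,
    memℓp_infty ⟨1, by rintro _ ⟨g, rfl⟩; dsimp only; split_ifs <;> simp⟩⟩
  have hind : ∀ S g, ind S g = if g • x₀ ∈ S then 1 else 0 := fun _ _ => rfl
  have hmono : ∀ f f' : ℓ^∞(Γ, ℝ), (∀ h, f h ≤ f' h) → m f ≤ m f' := by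
    intro f f' hff
    have := hmpos (f' - f) fun h => by
      rw [lp.coeFn_sub, Pi.sub_apply]
      exact sub_nonneg.2 (hff h)
    rw [map_sub] at this
    linarith
  have hsmul : ∀ (g : Γ) (S : Set X), m (ind (g • S)) = m (ind S) := by
    intro g S
    refine hminv g _ _ fun h => ?_
    rw [hind, hind, mul_smul]
    simp only [Set.mem_smul_set_iff_inv_smul_mem]
  have hle : ∀ H ∈ 𝓗, ∀ K ∈ 𝓗, m (ind H) ≤ m (ind K) := by
    intro H hH K hK
    obtain ⟨g, hg⟩ := hcompr H hH K hK
    rw [← hsmul g H]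
    refine hmono _ _ fun h => ?_
    rw [hind, hind]
    split_ifs with ha hb hb
    · exact le_rfl
    · exact absurd (hg ha) hb
    · exact zero_le_one
    · exact le_rfl
  have hcompl' : m (ind H₁) + m (ind H₁ᶜ) = 1 := by
    rw [← map_add, ← hm1]
    congr 1
    apply lp.ext
    funext h
    rw [lp.coeFn_add, Pi.add_apply, hind, hind]
    by_cases hx : h • x₀ ∈ H₁ <;> simp [hx]
  have hthree : m (ind H₁) + m (ind H₂) + m (ind H₃) ≤ 1 := by
    rw [← map_add, ← map_add, ← hm1]
    refine hmono _ _ fun h => ?_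
    rw [lp.coeFn_add, Pi.add_apply, lp.coeFn_add, Pi.add_apply, hind, hind, hind]
    change _ ≤ (1 : ℝ)
    by_cases hx₁ : h • x₀ ∈ H₁
    · rw [if_pos hx₁, if_neg (Set.disjoint_left.1 h₁₂ hx₁), if_neg (Set.disjoint_left.1 h₁₃ hx₁)]
      norm_num
    · by_cases hx₂ : h • x₀ ∈ H₂
      · rw [if_neg hx₁, if_pos hx₂, if_neg (Set.disjoint_left.1 h₂₃ hx₂)]
        norm_num
      · rw [if_neg hx₁, if_neg hx₂]
        split_ifs <;> norm_num
  have e₁ := hle H₁ᶜ (hcompl _ h₁) H₁ h₁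
  have e₂ := hle H₁ h₁ H₂ h₂
  have e₃ := hle H₁ h₁ H₃ h₃
  linarith

end Amenability

end NCJI

end

noncomputable section

namespace NCJI

open scoped ENNReal ComplexOrder InnerProductSpace lp

universe u v

/-! ### Locally finite stabilizers and a proper ideal -/

section NotCStarSimple

open Filter Topology

/-- The bounded operators that tend to zero along a bounded sequence of vectors. -/
def vanishingAlong {H : Type*} [NormedAddCommGroup H] [NormedSpace ℂ H] (η : ℕ → H) :
    Submodule ℂ (H →L[ℂ] H) where
  carrier := {y | Tendsto (fun n => y (η n)) atTop (𝓝 0)}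
  zero_mem' := tendsto_const_nhds
  add_mem' := fun {x y} hx hy => by
    have := Tendsto.add hx hy
    rwa [add_zero] at this
  smul_mem' := fun c x hx => by
    have := Tendsto.const_smul hx c
    rwa [smul_zero] at this

theorem mem_vanishingAlong {H : Type*} [NormedAddCommGroup H] [NormedSpace ℂ H] {η : ℕ → H}
    {y : H →L[ℂ] H} : y ∈ vanishingAlong η ↔ Tendsto (fun n => y (η n)) atTop (𝓝 0) := Iff.rfl

theorem isClosed_vanishingAlong {H : Type*} [NormedAddCommGroup H] [NormedSpace ℂ H] {η : ℕ → H}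
    (hη : ∀ n, ‖η n‖ ≤ 1) : IsClosed (vanishingAlong η : Set (H →L[ℂ] H)) := by
  refine isClosed_of_closure_subset fun x hx => ?_
  rw [SetLike.mem_coe, mem_vanishingAlong, Metric.tendsto_atTop]
  intro ε hε
  obtain ⟨y, hy, hxy⟩ := Metric.mem_closure_iff.1 hx (ε / 2) (half_pos hε)
  obtain ⟨N, hN⟩ := Metric.tendsto_atTop.1 (mem_vanishingAlong.1 hy) (ε / 2) (half_pos hε)
  refine ⟨N, fun n hn => ?_⟩
  have h1 := hN n hn
  rw [dist_zero_right] at h1 ⊢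
  have h2 : ‖(x - y) (η n)‖ ≤ dist x y := by
    rw [dist_eq_norm]
    exact ((x - y).le_opNorm _).trans (mul_le_of_le_one_right (norm_nonneg _) (hη n))
  have h3 : x (η n) = (x - y) (η n) + y (η n) := by simp
  rw [h3]
  exact (norm_add_le _ _).trans_lt (by linarith)

variable {Γ : Type u} [Group Γ]

open Classical in
/-- The normalized indicator function of a finite subgroup. -/
def subgroupVector (L : Subgroup Γ) [Finite L] : ℓ²(Γ, ℂ) :=
  ((√(Nat.card L) : ℝ) : ℂ)⁻¹ •
    ∑ l ∈ (Set.toFinite (L : Set Γ)).toFinset, lp.single 2 l (1 : ℂ)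

theorem norm_subgroupVector (L : Subgroup Γ) [Finite L] : ‖subgroupVector L‖ = 1 := by
  classical
  have h2 : 0 < (2 : ℝ≥0∞).toReal := by norm_num
  have hcard : (Set.toFinite (L : Set Γ)).toFinset.card = Nat.card L :=
    (Nat.card_eq_card_finite_toFinset (Set.toFinite (L : Set Γ))).symm
  have hsum := lp.norm_sum_single (E := fun _ : Γ => ℂ) h2 (fun _ => (1 : ℂ))
    (Set.toFinite (L : Set Γ)).toFinset
  have hn : ‖∑ l ∈ (Set.toFinite (L : Set Γ)).toFinset,
      (lp.single 2 l (1 : ℂ) : ℓ²(Γ, ℂ))‖ = √(Nat.card L) := by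
    rw [eq_comm, Real.sqrt_eq_iff_eq_sq (by positivity) (norm_nonneg _), ← hcard]
    simpa using hsum.symm
  have hpos : 0 < √(Nat.card L : ℝ) := Real.sqrt_pos.2 (by exact_mod_cast Nat.card_pos)
  rw [subgroupVector, norm_smul, norm_inv, Complex.norm_real, Real.norm_of_nonneg hpos.le]
  convert inv_mul_cancel₀ hpos.ne' using 2

theorem leftRegular_subgroupVector (L : Subgroup Γ) [Finite L] {g : Γ} (hg : g ∈ L) :
    (leftRegular Γ g : ℓ²(Γ, ℂ) →L[ℂ] ℓ²(Γ, ℂ)) (subgroupVector L) = subgroupVector L := by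
  rw [subgroupVector, map_smul, map_sum]
  congr 1
  simp only [leftRegular_single]
  refine Finset.sum_bij' (fun l _ => g * l) (fun l _ => g⁻¹ * l) ?_ ?_ ?_ ?_ ?_
  · intro l hl
    rw [Set.Finite.mem_toFinset] at hl ⊢
    exact L.mul_mem hg hl
  · intro l hl
    rw [Set.Finite.mem_toFinset] at hl ⊢
    exact L.mul_mem (L.inv_mem hg) hl
  · intro l _; simp
  · intro l _; simp
  · intro l _; rfl

theorem one_sub_mul_one_sub_apply (a b h : Γ) (v : ℓ²(Γ, ℂ)) :
    (((1 - regularOf Γ a) * (1 - regularOf Γ b) * regularOf Γ h : ReducedCStar Γ) :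
      ℓ²(Γ, ℂ) →L[ℂ] ℓ²(Γ, ℂ)) v =
      (leftRegular Γ h : ℓ²(Γ, ℂ) →L[ℂ] ℓ²(Γ, ℂ)) v -
        (leftRegular Γ (b * h) : ℓ²(Γ, ℂ) →L[ℂ] ℓ²(Γ, ℂ)) v -
        ((leftRegular Γ (a * h) : ℓ²(Γ, ℂ) →L[ℂ] ℓ²(Γ, ℂ)) v -
          (leftRegular Γ (a * (b * h)) : ℓ²(Γ, ℂ) →L[ℂ] ℓ²(Γ, ℂ)) v) := by
  have e : (1 - regularOf Γ a) * (1 - regularOf Γ b) * regularOf Γ h =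
      regularOf Γ h - regularOf Γ (b * h) - (regularOf Γ (a * h) - regularOf Γ (a * (b * h))) := by
    simp only [regularOf_mul]
    noncomm_ring
  rw [e]
  rfl

theorem one_sub_mul_one_sub_ne_zero {a b : Γ} (ha : a ≠ 1) (hb : b ≠ 1) :
    (1 - regularOf Γ a) * (1 - regularOf Γ b) ≠ 0 := by
  classical
  intro hw
  have h0 := one_sub_mul_one_sub_apply a b 1 (lp.single 2 1 (1 : ℂ))
  rw [hw, zero_mul] at h0
  simp only [leftRegular_single, mul_one] at h0
  have h1 := congrArg (fun v : ℓ²(Γ, ℂ) => ((v : Γ → ℂ) 1).re) h0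
  simp only [lp.coeFn_sub, Pi.sub_apply, lp.single_apply, Pi.single_apply, if_neg ha.symm,
    if_neg hb.symm, if_true] at h1
  have h2 : (0 : ℝ) ≤ (if (1 : Γ) = a * b then (1 : ℂ) else 0).re := by
    split_ifs <;> simp
  have h3 : (0 : ℝ) = (1 - 0 - (0 - (if (1 : Γ) = a * b then (1 : ℂ) else 0))).re := h1
  rw [sub_zero, zero_sub, sub_neg_eq_add, Complex.add_re, Complex.one_re] at h3
  linarith

section

variable {X : Type*} [MulAction Γ X] {x₀ : X} {L : ℕ → Subgroup Γ} [hfin : ∀ n, Finite (L n)]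

theorem eventually_leftRegular_subgroupVector (hmono : Monotone L)
    (hstab : ∀ g : Γ, g • x₀ = x₀ → ∃ n, g ∈ L n) {g h : Γ} (hgh : g • h • x₀ = h • x₀) :
    ∀ᶠ n in atTop,
      (leftRegular Γ (g * h) : ℓ²(Γ, ℂ) →L[ℂ] ℓ²(Γ, ℂ)) (subgroupVector (L n)) =
        (leftRegular Γ h : ℓ²(Γ, ℂ) →L[ℂ] ℓ²(Γ, ℂ)) (subgroupVector (L n)) := by
  obtain ⟨N, hN⟩ := hstab (h⁻¹ * g * h) (by rw [mul_smul, mul_smul, hgh, inv_smul_smul])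
  filter_upwards [eventually_ge_atTop N] with n hn
  have h1 := leftRegular_subgroupVector (L n) (hmono hn hN)
  have e : g * h = h * (h⁻¹ * g * h) := by group
  rw [e, map_mul]
  exact congrArg (leftRegular Γ h : ℓ²(Γ, ℂ) →L[ℂ] ℓ²(Γ, ℂ)) h1

theorem one_sub_mul_one_sub_mul_mem_vanishingAlong (hmono : Monotone L)
    (hstab : ∀ g : Γ, g • x₀ = x₀ → ∃ n, g ∈ L n) {a b : Γ}
    (hab : ∀ x : X, a • x = x ∨ b • x = x) (z : ReducedCStar Γ) :
    (((1 - regularOf Γ a) * (1 - regularOf Γ b) * z : ReducedCStar Γ) :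
      ℓ²(Γ, ℂ) →L[ℂ] ℓ²(Γ, ℂ)) ∈ vanishingAlong fun n => subgroupVector (L n) := by
  set w : ReducedCStar Γ := (1 - regularOf Γ a) * (1 - regularOf Γ b) with hw
  set V := vanishingAlong fun n => subgroupVector (L n) with hV
  have hcl : IsClosed ((fun z : ReducedCStar Γ =>
      ((w * z : ReducedCStar Γ) : ℓ²(Γ, ℂ) →L[ℂ] ℓ²(Γ, ℂ))) ⁻¹' V) :=
    (isClosed_vanishingAlong fun n => (norm_subgroupVector (L n)).le).preimage
      (continuous_subtype_val.comp (continuous_const.mul continuous_id))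
  refine closure_minimal (fun y hy => ?_) hcl (mem_closure_span_regularOf z)
  rw [Set.mem_preimage, SetLike.mem_coe]
  induction hy using Submodule.span_induction with
  | mem y hy =>
    obtain ⟨h, rfl⟩ := hy
    rw [hV, mem_vanishingAlong]
    refine tendsto_nhds_of_eventually_eq ?_
    -- If `b` fixes `h • x₀`, then `1 - b` eventually kills the translated vector. Otherwise `b`
    -- fixes neither `h • x₀` nor its image under `b`, so `a` fixes both and `1 - a` kills both
    -- terms.
    by_cases hbx : b • h • x₀ = h • x₀
    · filter_upwards [eventually_leftRegular_subgroupVector hmono hstab hbx] with n h1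
      have h2 : (leftRegular Γ (a * (b * h)) : ℓ²(Γ, ℂ) →L[ℂ] ℓ²(Γ, ℂ)) (subgroupVector (L n)) =
          (leftRegular Γ (a * h) : ℓ²(Γ, ℂ) →L[ℂ] ℓ²(Γ, ℂ)) (subgroupVector (L n)) := by
        rw [map_mul (leftRegular Γ) a, map_mul (leftRegular Γ) a]
        exact congrArg (leftRegular Γ a : ℓ²(Γ, ℂ) →L[ℂ] ℓ²(Γ, ℂ)) h1
      rw [hw, one_sub_mul_one_sub_apply, h1, h2, sub_self, sub_self, sub_self]
    · have hax : a • h • x₀ = h • x₀ := (hab _).resolve_right hbx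
      have hax' : a • (b * h) • x₀ = (b * h) • x₀ := by
        refine (hab _).resolve_right fun hbb => hbx ?_
        rw [mul_smul] at hbb
        exact smul_left_cancel b hbb
      filter_upwards [eventually_leftRegular_subgroupVector hmono hstab hax,
        eventually_leftRegular_subgroupVector hmono hstab hax'] with n h1 h2
      rw [hw, one_sub_mul_one_sub_apply, h1, h2, sub_self]
  | zero => rw [mul_zero]; exact V.zero_mem
  | add y z _ _ hy hz => rw [mul_add]; exact V.add_mem hy hz
  | smul c y _ hy => rw [mul_smul_comm]; exact V.smul_mem c hy

/-- If point stabilizers at `x₀` are increasing unions of finite subgroups and two nontrivial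
elements have disjoint supports, then the reduced C*-algebra is not simple. -/
theorem not_isCStarSimple_of_locally_finite_stabilizer (hmono : Monotone L)
    (hstab : ∀ g : Γ, g • x₀ = x₀ → ∃ n, g ∈ L n) {a b : Γ} (ha : a ≠ 1) (hb : b ≠ 1)
    (hab : ∀ x : X, a • x = x ∨ b • x = x) : ¬ IsCStarSimple Γ := by
  intro hsimple
  set V := vanishingAlong fun n => subgroupVector (L n) with hV
  have hcl : IsClosed (V : Set (ℓ²(Γ, ℂ) →L[ℂ] ℓ²(Γ, ℂ))) :=
    isClosed_vanishingAlong fun n => (norm_subgroupVector (L n)).le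
  -- Vanishing along the vectors is only a left ideal condition; quantifying over `z` makes it
  -- two-sided. The unit vectors keep `1` out of `I`.
  let I : TwoSidedIdeal (ReducedCStar Γ) := TwoSidedIdeal.mk'
    {x | ∀ z : ReducedCStar Γ, ((x * z : ReducedCStar Γ) : ℓ²(Γ, ℂ) →L[ℂ] ℓ²(Γ, ℂ)) ∈ V}
    (fun z => by rw [zero_mul]; exact V.zero_mem)
    (fun {x y} hx hy z => by rw [add_mul]; exact V.add_mem (hx z) (hy z))
    (fun {x} hx z => by rw [neg_mul]; exact V.neg_mem (hx z))
    (fun {x y} hy z => by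
      have h := ((x : ℓ²(Γ, ℂ) →L[ℂ] ℓ²(Γ, ℂ)).continuous.tendsto 0).comp
        (mem_vanishingAlong.1 (hy z))
      rw [map_zero] at h
      rw [mul_assoc]
      exact h)
    (fun {x y} hx z => by rw [mul_assoc]; exact hx (y * z))
  have hI : ∀ x, x ∈ I ↔
      ∀ z : ReducedCStar Γ, ((x * z : ReducedCStar Γ) : ℓ²(Γ, ℂ) →L[ℂ] ℓ²(Γ, ℂ)) ∈ V :=
    fun x => TwoSidedIdeal.mem_mk' _ _ _ _ _ _ x
  have hIcl : IsClosed (I : Set (ReducedCStar Γ)) := by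
    have e : (I : Set (ReducedCStar Γ)) = ⋂ z : ReducedCStar Γ, (fun x : ReducedCStar Γ =>
        ((x * z : ReducedCStar Γ) : ℓ²(Γ, ℂ) →L[ℂ] ℓ²(Γ, ℂ))) ⁻¹' V := by
      ext x
      rw [SetLike.mem_coe, hI, Set.mem_iInter]
      rfl
    rw [e]
    exact isClosed_iInter fun z => hcl.preimage
      (continuous_subtype_val.comp (continuous_id.mul continuous_const))
  rcases hsimple I hIcl with h | h
  · have hw := (hI _).2 (one_sub_mul_one_sub_mul_mem_vanishingAlong hmono hstab hab)
    rw [h, TwoSidedIdeal.mem_bot] at hw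
    exact one_sub_mul_one_sub_ne_zero ha hb hw
  · have h1 : (1 : ReducedCStar Γ) ∈ I := by rw [h]; trivial
    have h2 := (hI 1).1 h1 1
    rw [one_mul, hV, mem_vanishingAlong] at h2
    have h3 := h2.norm
    have h4 : ∀ n, ‖((1 : ReducedCStar Γ) : ℓ²(Γ, ℂ) →L[ℂ] ℓ²(Γ, ℂ)) (subgroupVector (L n))‖ = 1 :=
      fun n => norm_subgroupVector (L n)
    simp only [h4, norm_zero] at h3
    exact one_ne_zero (tendsto_nhds_unique tendsto_const_nhds h3)

end

end NotCStarSimple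

end NCJI

end

noncomputable section

namespace NCJI

/-! ### Reduced words in free products -/

section FreeProducts

open Monoid Monoid.CoprodI

variable {ι : Type*} [DecidableEq ι] {M : ι → Type*} [∀ i, Group (M i)] [∀ i, DecidableEq (M i)]

/-- The sequence of indices of the letters of the reduced word of `x`. -/
def typ (x : CoprodI M) : List ι := (Word.equiv x).toList.map Sigma.fst

theorem typ_prod_word (w : Word M) : typ w.prod = w.toList.map Sigma.fst := by
  rw [typ, show Word.equiv w.prod = w from Word.equiv.apply_symm_apply w]

theorem typ_prod_neWord {i j : ι} (w : NeWord M i j) : typ w.prod = w.toList.map Sigma.fst :=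
  typ_prod_word w.toWord

theorem exists_neWord_prod_eq {x : CoprodI M} (hx : x ≠ 1) :
    ∃ (i j : ι) (w : NeWord M i j), w.prod = x := by
  have hne : Word.equiv x ≠ Word.empty := by
    intro h
    apply hx
    rw [← Word.equiv.symm_apply_apply x, h]
    exact Word.prod_empty
  obtain ⟨i, j, w, hw⟩ := NeWord.of_word _ hne
  refine ⟨i, j, w, ?_⟩
  rw [NeWord.prod, hw]
  exact Word.equiv.symm_apply_apply x

@[simp]
theorem typ_one : typ (1 : CoprodI M) = [] := by
  rw [← Word.prod_empty, typ_prod_word]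
  rfl

theorem typ_head?_neWord {i j : ι} (w : NeWord M i j) : (typ w.prod).head? = some i := by
  rw [typ_prod_neWord, List.head?_map, NeWord.toList_head?]
  rfl

theorem typ_getLast?_neWord {i j : ι} (w : NeWord M i j) : (typ w.prod).getLast? = some j := by
  rw [typ_prod_neWord, List.getLast?_map, NeWord.toList_getLast?]
  rfl

theorem typ_eq_nil_iff {x : CoprodI M} : typ x = [] ↔ x = 1 := by
  refine ⟨fun h => ?_, fun h => h ▸ typ_one⟩
  by_contra hx
  obtain ⟨i, j, w, rfl⟩ := exists_neWord_prod_eq hx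
  have := typ_head?_neWord w
  rw [h] at this
  simp at this

theorem typ_of {i : ι} {a : M i} (ha : a ≠ 1) : typ (CoprodI.of a) = [i] := by
  rw [← NeWord.prod_singleton a ha, typ_prod_neWord]
  rfl

theorem typ_mul {x y : CoprodI M}
    (h : ∀ i, (typ x).getLast? = some i → (typ y).head? ≠ some i) :
    typ (x * y) = typ x ++ typ y := by
  by_cases hx : x = 1
  · simp [hx]
  by_cases hy : y = 1
  · simp [hy]
  obtain ⟨i, j, w, rfl⟩ := exists_neWord_prod_eq hx
  obtain ⟨k, l, v, rfl⟩ := exists_neWord_prod_eq hy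
  have hjk : j ≠ k := by
    rintro rfl
    exact h j (typ_getLast?_neWord w) (typ_head?_neWord v)
  rw [← NeWord.append_prod (hne := hjk), typ_prod_neWord, typ_prod_neWord, typ_prod_neWord,
    ← List.map_append]
  rfl

theorem typ_inv (x : CoprodI M) : typ x⁻¹ = (typ x).reverse := by
  by_cases hx : x = 1
  · simp [hx]
  obtain ⟨i, j, w, rfl⟩ := exists_neWord_prod_eq hx
  rw [← NeWord.inv_prod, typ_prod_neWord, typ_prod_neWord]
  clear hx
  induction w with
  | singleton a ha => rfl
  | append w₁ h w₂ ih₁ ih₂ =>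
    simp only [NeWord.inv, NeWord.toList, List.map_append, List.reverse_append, ih₁, ih₂]

theorem head?_typ_mul {x y : CoprodI M} (hx : x ≠ 1)
    (h : (typ x).getLast? ≠ (typ y).head?) : (typ (x * y)).head? = (typ x).head? := by
  rw [typ_mul fun i hi hi' => h (hi.trans hi'.symm), List.head?_append_of_ne_nil]
  rwa [Ne, typ_eq_nil_iff]

/-- The `M i`-component of the first letter of `x` (`1` if `x` does not start in `M i`). -/
def firstLetter (i : ι) (x : CoprodI M) : M i := (Word.equivPair i (Word.equiv x)).head

theorem exists_firstLetter_mul (i : ι) (x : CoprodI M) :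
    ∃ u : CoprodI M, (typ u).head? ≠ some i ∧ x = CoprodI.of (firstLetter i x) * u := by
  set p := Word.equivPair i (Word.equiv x) with hp
  refine ⟨p.tail.prod, ?_, ?_⟩
  · rw [typ_prod_word, List.head?_map]
    exact p.fstIdx_ne
  · have h1 : Word.rcons p = Word.equiv x := by
      rw [← Word.equivPair_symm, hp, Equiv.symm_apply_apply]
    have h2 := Word.prod_rcons p
    rw [h1] at h2
    rw [firstLetter, ← hp, ← h2]
    exact (Word.equiv.symm_apply_apply x).symm

theorem firstLetter_of_mul (i : ι) (a : M i) {u : CoprodI M} (hu : (typ u).head? ≠ some i) :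
    firstLetter i (CoprodI.of a * u) = a := by
  have hu' : (Word.equiv u).fstIdx ≠ some i := by
    rw [typ, List.head?_map] at hu
    exact hu
  let p : Word.Pair M i := ⟨a, Word.equiv u, hu'⟩
  have h1 : Word.equiv (CoprodI.of a * u) = Word.rcons p := by
    have h2 := Word.prod_rcons p
    have h3 : p.tail.prod = u := Word.equiv.symm_apply_apply u
    rw [h3] at h2
    rw [← h2]
    exact Word.equiv.apply_symm_apply _
  rw [firstLetter, h1, ← Word.equivPair_symm, Equiv.apply_symm_apply]

theorem exists_eq_mul_of {x : CoprodI M} (hx : x ≠ 1) :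
    ∃ (y : CoprodI M) (i : ι) (s : M i), x = y * CoprodI.of s ∧ s ≠ 1 ∧
      (typ y).getLast? ≠ some i := by
  obtain ⟨i, j, w, hw⟩ := exists_neWord_prod_eq (inv_ne_one.2 hx)
  have hhead : (typ x⁻¹).head? = some i := hw ▸ typ_head?_neWord w
  obtain ⟨u, hu, hxu⟩ := exists_firstLetter_mul i x⁻¹
  have hne : firstLetter i x⁻¹ ≠ 1 := by
    intro h
    rw [h, map_one, one_mul] at hxu
    exact hu (hxu ▸ hhead)
  refine ⟨u⁻¹, i, (firstLetter i x⁻¹)⁻¹, ?_, inv_ne_one.2 hne, ?_⟩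
  · rw [map_inv, ← mul_inv_rev, ← hxu, inv_inv]
  · rwa [typ_inv, List.getLast?_reverse]

theorem typ_mul_of {y : CoprodI M} {i : ι} {s : M i} (hs : s ≠ 1)
    (hy : (typ y).getLast? ≠ some i) : typ (y * CoprodI.of s) = typ y ++ [i] := by
  rw [typ_mul, typ_of hs]
  intro k hk
  rw [typ_of hs, List.head?_singleton]
  rintro ⟨⟩
  exact hy hk

theorem head?_typ_mul_of_ne {y : CoprodI M} {i : ι} (hy : y ≠ 1)
    (h : (typ y).getLast? ≠ some i) (s : M i) :
    (typ (y * CoprodI.of s)).head? = (typ y).head? := by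
  by_cases hs : s = 1
  · rw [hs, map_one, mul_one]
  · rw [typ_mul_of hs h, List.head?_append_of_ne_nil]
    rwa [Ne, typ_eq_nil_iff]

/-- A letter on the right affects the first letter of a nontrivial word only if the word is a single
letter of the same factor; the product then stays in that factor. -/
theorem head?_typ_mul_of_ne_some {t : CoprodI M} {i : ι} (ht : t ≠ 1) (h : (typ t).head? ≠ some i)
    (j : ι) (s : M j) : (typ (t * CoprodI.of s)).head? ≠ some i := by
  obtain ⟨y, k, c, rfl, hc, hy⟩ := exists_eq_mul_of ht
  by_cases hkj : k = j
  · subst hkj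
    rw [mul_assoc, ← map_mul]
    by_cases hy1 : y = 1
    · rw [hy1, one_mul] at h ⊢
      by_cases hcs : c * s = 1
      · simp [hcs]
      · rwa [typ_of hcs, ← typ_of hc]
    · rw [head?_typ_mul_of_ne hy1 hy] at h ⊢
      exact h
  · rwa [head?_typ_mul_of_ne ht]
    rw [typ_mul_of hc hy, List.getLast?_append]
    simpa using hkj

theorem finite_setOf_length_typ_le [Finite ι] [∀ i, Finite (M i)] (n : ℕ) :
    {x : CoprodI M | (typ x).length ≤ n}.Finite := by
  induction n with
  | zero =>
    refine (Set.finite_singleton (1 : CoprodI M)).subset fun x hx => ?_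
    exact typ_eq_nil_iff.1 (List.length_eq_zero_iff.1 (Nat.le_zero.1 hx))
  | succ n ih =>
    refine ((Set.finite_singleton (1 : CoprodI M)).union
      (ih.image2 (fun y (p : Σ i, M i) => y * CoprodI.of p.2) Set.finite_univ)).subset fun x hx => ?_
    by_cases hx1 : x = 1
    · exact Or.inl hx1
    · obtain ⟨y, i, s, rfl, hs, hy⟩ := exists_eq_mul_of hx1
      refine Or.inr ⟨y, ?_, ⟨i, s⟩, Set.mem_univ _, rfl⟩
      have hx' : (typ (y * CoprodI.of s)).length ≤ n + 1 := hx
      rw [typ_mul_of hs hy, List.length_append] at hx'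
      exact Nat.le_of_succ_le_succ hx'

end FreeProducts

end NCJI

end

noncomputable section

namespace NCJI

/-! ### Almost-translating automorphisms of the Bass-Serre tree -/

section TreeGroup

open Monoid Monoid.CoprodI
open scoped Pointwise

variable {ι : Type*} [DecidableEq ι] {M : ι → Type*} [∀ i, Group (M i)] [∀ i, DecidableEq (M i)]

/-- The permutations of a free product that preserve the type of `x⁻¹ * y` and commute with right
multiplication by each letter up to finitely many exceptions. These are the automorphisms of the
Bass-Serre tree that preserve the types of the edges and act locally by translations almost
everywhere. -/
def treeGroup (M : ι → Type*) [∀ i, Group (M i)] [∀ i, DecidableEq (M i)] :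
    Subgroup (Equiv.Perm (CoprodI M)) where
  carrier := {g | (∀ x y, typ ((g x)⁻¹ * g y) = typ (x⁻¹ * y)) ∧
    ∀ i (s : M i), {x | g (x * CoprodI.of s) ≠ g x * CoprodI.of s}.Finite}
  one_mem' := ⟨fun _ _ => rfl, fun _ _ => by simp⟩
  mul_mem' := by
    rintro g h ⟨hg, hg'⟩ ⟨hh, hh'⟩
    refine ⟨fun x y => (hg _ _).trans (hh _ _), fun i s =>
      ((hh' i s).union ((hg' i s).preimage h.injective.injOn)).subset fun x hx => ?_⟩
    by_contra hx'
    simp only [Set.mem_union, Set.mem_ofPred_eq, Set.mem_preimage, not_or, not_not] at hx'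
    exact hx (by rw [Equiv.Perm.mul_apply, Equiv.Perm.mul_apply, hx'.1, hx'.2])
  inv_mem' := by
    rintro g ⟨hg, hg'⟩
    refine ⟨fun x y => ?_, fun i s => ((hg' i s).image g).subset fun x hx => ?_⟩
    · rw [← hg, Equiv.Perm.coe_inv, g.apply_symm_apply, g.apply_symm_apply]
    · refine ⟨g⁻¹ x, fun h => hx ?_, g.apply_symm_apply x⟩
      rw [Equiv.Perm.inv_eq_iff_eq, h, Equiv.Perm.coe_inv, g.apply_symm_apply]

theorem mulLeft_mem_treeGroup (d : CoprodI M) : Equiv.mulLeft d ∈ treeGroup M := by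
  refine ⟨fun x y => ?_, fun i s => ?_⟩
  · congr 1
    simp [mul_assoc]
  · simp [mul_assoc]

theorem treeGroup_smul_def (g : treeGroup M) (x : CoprodI M) :
    g • x = (g : Equiv.Perm (CoprodI M)) x := rfl

theorem typ_smul (g : treeGroup M) (x y : CoprodI M) :
    typ ((g • x)⁻¹ * g • y) = typ (x⁻¹ * y) := g.2.1 x y

/-- The half-space at `x` in the direction `i`: the `y` for which the reduced word of `x⁻¹ * y`
starts in `M i`. -/
def branch (i : ι) (x : CoprodI M) : Set (CoprodI M) := {y | (typ (x⁻¹ * y)).head? = some i}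

theorem mem_branch {i : ι} {x y : CoprodI M} :
    y ∈ branch i x ↔ (typ (x⁻¹ * y)).head? = some i := Iff.rfl

theorem smul_branch (g : treeGroup M) (i : ι) (x : CoprodI M) :
    g • branch i x = branch i (g • x) := by
  ext y
  rw [Set.mem_smul_set_iff_inv_smul_mem, mem_branch, mem_branch, ← typ_smul g, smul_inv_smul]

theorem head?_typ_inv_mul {x y z : CoprodI M} (hxy : x ≠ y)
    (h : (typ (x⁻¹ * y)).getLast? ≠ (typ (y⁻¹ * z)).head?) :
    (typ (x⁻¹ * z)).head? = (typ (x⁻¹ * y)).head? := by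
  rw [← head?_typ_mul _ h]
  · congr 2
    group
  · rwa [Ne, inv_mul_eq_one]

variable (M) in
/-- The half-spaces `branch i x` and their complements. -/
def halfSpaces : Set (Set (CoprodI M)) := {S | ∃ i x, S = branch i x ∨ S = (branch i x)ᶜ}

theorem branch_mem_halfSpaces (i : ι) (x : CoprodI M) : branch i x ∈ halfSpaces M :=
  ⟨i, x, Or.inl rfl⟩

theorem compl_mem_halfSpaces {H : Set (CoprodI M)} (hH : H ∈ halfSpaces M) :
    Hᶜ ∈ halfSpaces M := by
  obtain ⟨i, x, rfl | rfl⟩ := hH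
  · exact ⟨i, x, Or.inr rfl⟩
  · exact ⟨i, x, Or.inl (compl_compl _)⟩

/-- For `x ≠ y`, any `z` that `y` does not see in the direction of `x` is seen from `x` in the
direction of `y`. The four cases are whether `y` lies in the branch at `x` and whether `x` lies in
the branch at `y`. -/
theorem branch_nested (i j : ι) (x y : CoprodI M) :
    branch i x ⊆ branch j y ∨ branch i x ⊆ (branch j y)ᶜ ∨
      (branch i x)ᶜ ⊆ branch j y ∨ (branch i x)ᶜ ⊆ (branch j y)ᶜ := by
  by_cases hxy : x = y
  · subst hxy
    by_cases hij : i = j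
    · exact Or.inl (hij ▸ subset_rfl)
    · refine Or.inr (Or.inl fun z hz hz' => hij ?_)
      exact Option.some.inj (hz.symm.trans hz')
  have key : ∀ z, (typ (x⁻¹ * y)).getLast? ≠ (typ (y⁻¹ * z)).head? →
      (z ∈ branch i x ↔ (typ (x⁻¹ * y)).head? = some i) := fun z hz => by
    rw [mem_branch, head?_typ_inv_mul hxy hz]
  by_cases hQ : (typ (x⁻¹ * y)).getLast? = some j
  · have hz : ∀ z ∉ branch j y, (typ (x⁻¹ * y)).getLast? ≠ (typ (y⁻¹ * z)).head? :=
      fun z hz h => hz (h.symm.trans hQ)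
    by_cases hP : (typ (x⁻¹ * y)).head? = some i
    · refine Or.inr (Or.inr (Or.inl fun z hzx => ?_))
      by_contra hzy
      exact hzx ((key z (hz z hzy)).2 hP)
    · refine Or.inl fun z hzx => ?_
      by_contra hzy
      exact hP ((key z (hz z hzy)).1 hzx)
  · have hz : ∀ z ∈ branch j y, (typ (x⁻¹ * y)).getLast? ≠ (typ (y⁻¹ * z)).head? :=
      fun z hz h => hQ (h.trans hz)
    by_cases hP : (typ (x⁻¹ * y)).head? = some i
    · exact Or.inr (Or.inr (Or.inr fun z hzx hzy => hzx ((key z (hz z hzy)).2 hP)))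
    · exact Or.inr (Or.inl fun z hzx hzy => hP ((key z (hz z hzy)).1 hzx))

theorem halfSpaces_nested {H K : Set (CoprodI M)} (hH : H ∈ halfSpaces M)
    (hK : K ∈ halfSpaces M) : H ⊆ K ∨ H ⊆ Kᶜ ∨ Hᶜ ⊆ K ∨ Hᶜ ⊆ Kᶜ := by
  obtain ⟨i, x, rfl | rfl⟩ := hH <;> obtain ⟨j, y, rfl | rfl⟩ := hK <;>
    rcases branch_nested i j x y with h | h | h | h <;> simp [h]

theorem compl_branch_subset {i : ι} {s : M i} (hs : s ≠ 1) (x : CoprodI M) :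
    (branch i x)ᶜ ⊆ branch i (x * CoprodI.of s) := by
  intro z hz
  have hs' : s⁻¹ ≠ 1 := inv_ne_one.2 hs
  rw [mem_branch, mul_inv_rev, ← map_inv, mul_assoc, head?_typ_mul, typ_of hs']
  · rfl
  · rw [Ne, ← typ_eq_nil_iff, typ_of hs']
    exact List.cons_ne_nil _ _
  · rw [typ_of hs']
    exact fun h => hz h.symm

/-- Walk from `y` into `K` along a word ending in a third factor `m`. Since `l ≠ m`, the branch of
type `l` at the endpoint points away from `y`. -/
theorem exists_branch_subset [∀ i, Nontrivial (M i)] (hι : ∀ i j : ι, ∃ k, k ≠ i ∧ k ≠ j)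
    {K : Set (CoprodI M)} (hK : K ∈ halfSpaces M) (l : ι) : ∃ z, branch l z ⊆ K := by
  obtain ⟨j, y, hK⟩ := hK
  obtain ⟨m, hmj, hml⟩ := hι j l
  obtain ⟨r, hr⟩ := exists_ne (1 : M m)
  obtain ⟨s, hs⟩ := exists_ne (1 : M j)
  have key : ∀ v : CoprodI M, (typ v).getLast? = some m → ∀ w ∈ branch l (y * v),
      (typ (y⁻¹ * w)).head? = (typ v).head? := by
    intro v hv w hw
    have hv1 : v ≠ 1 := by
      rintro rfl
      simp at hv
    have := head?_typ_inv_mul (x := y) (y := y * v) (z := w) (by simpa using hv1)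
    rw [inv_mul_cancel_left] at this
    refine this ?_
    rw [hv, mem_branch.1 hw]
    simpa using hml
  rcases hK with rfl | rfl
  · have htyp : typ (CoprodI.of s * CoprodI.of r) = [j] ++ [m] := by
      rw [typ_mul_of hr, typ_of hs]
      rw [typ_of hs]
      simpa using hmj.symm
    refine ⟨y * (CoprodI.of s * CoprodI.of r), fun w hw => ?_⟩
    rw [mem_branch, key _ (by rw [htyp]; rfl) w hw, htyp]
    rfl
  · refine ⟨y * CoprodI.of r, fun w hw hw' => ?_⟩
    rw [mem_branch, key _ (by rw [typ_of hr]; rfl) w hw, typ_of hr] at hw'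
    exact hmj (Option.some.inj hw')

theorem exists_smul_halfSpace_subset [∀ i, Nontrivial (M i)]
    (hι : ∀ i j : ι, ∃ k, k ≠ i ∧ k ≠ j) {H K : Set (CoprodI M)} (hH : H ∈ halfSpaces M)
    (hK : K ∈ halfSpaces M) : ∃ g : treeGroup M, g • H ⊆ K := by
  obtain ⟨i, x, hHx⟩ : ∃ i x, H ⊆ branch i x := by
    obtain ⟨i, x, rfl | rfl⟩ := hH
    · exact ⟨i, x, subset_rfl⟩
    · obtain ⟨s, hs⟩ := exists_ne (1 : M i)
      exact ⟨i, _, compl_branch_subset hs x⟩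
  obtain ⟨z, hz⟩ := exists_branch_subset hι hK i
  refine ⟨⟨Equiv.mulLeft (z * x⁻¹), mulLeft_mem_treeGroup _⟩,
    (Set.smul_set_mono hHx).trans ?_⟩
  rw [smul_branch, treeGroup_smul_def]
  simpa using hz

theorem exists_disjoint_smul_halfSpace (hι : ∀ i j : ι, ∃ k, k ≠ i ∧ k ≠ j) {g : treeGroup M}
    (hg : g ≠ 1) : ∃ H ∈ halfSpaces M, Disjoint (g • H) H := by
  obtain ⟨x, hx⟩ : ∃ x : CoprodI M, x ≠ g • x := by
    by_contra! h
    exact hg (Subtype.ext (Equiv.ext fun x => (h x).symm))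
  obtain ⟨i, j, w, hw⟩ := exists_neWord_prod_eq (inv_mul_eq_one.not.2 hx)
  -- With `k` different from the first and last types on the way from `x` to `g • x`, the two
  -- branches of type `k` point away from each other.
  obtain ⟨k, hki, hkj⟩ := hι i j
  refine ⟨branch k x, branch_mem_halfSpaces k x, Set.disjoint_left.2 fun z hz hz' => hki ?_⟩
  rw [smul_branch, mem_branch] at hz
  rw [mem_branch, head?_typ_inv_mul hx, ← hw, typ_head?_neWord] at hz'
  · exact (Option.some.inj hz').symm
  · rw [← hw, typ_getLast?_neWord, hz]
    simpa using hkj.symm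

/-- The map applying `τ` to the `M i`-component of the first letter. -/
def twist (i : ι) (τ : Equiv.Perm (M i)) (x : CoprodI M) : CoprodI M :=
  CoprodI.of (τ (firstLetter i x)) * (CoprodI.of (firstLetter i x))⁻¹ * x

theorem twist_of_mul {i : ι} (τ : Equiv.Perm (M i)) (a : M i) {u : CoprodI M}
    (hu : (typ u).head? ≠ some i) :
    twist i τ (CoprodI.of a * u) = CoprodI.of (τ a) * u := by
  rw [twist, firstLetter_of_mul i a hu, mul_assoc, inv_mul_cancel_left]

theorem twist_twist {i : ι} (σ τ : Equiv.Perm (M i)) (x : CoprodI M) :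
    twist i σ (twist i τ x) = twist i (σ * τ) x := by
  obtain ⟨u, hu, hx⟩ := exists_firstLetter_mul i x
  rw [hx, twist_of_mul τ _ hu, twist_of_mul σ _ hu, twist_of_mul _ _ hu, Equiv.Perm.mul_apply]

theorem twist_one (i : ι) (x : CoprodI M) : twist i 1 x = x := by
  rw [twist, Equiv.Perm.one_apply, mul_inv_cancel, one_mul]

/-- `twist` as a permutation. -/
def twistPerm (i : ι) (τ : Equiv.Perm (M i)) : Equiv.Perm (CoprodI M) where
  toFun := twist i τ
  invFun := twist i τ⁻¹
  left_inv x := by rw [twist_twist, inv_mul_cancel, twist_one]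
  right_inv x := by rw [twist_twist, mul_inv_cancel, twist_one]

theorem typ_inv_mul_of_mul {i : ι} {c : M i} (hc : c ≠ 1) {u v : CoprodI M}
    (hu : (typ u).head? ≠ some i) (hv : (typ v).head? ≠ some i) :
    typ (u⁻¹ * CoprodI.of c * v) = (typ u).reverse ++ [i] ++ typ v := by
  have h : typ (u⁻¹ * CoprodI.of c) = (typ u).reverse ++ [i] := by
    rw [typ_mul_of hc, typ_inv]
    rwa [typ_inv, List.getLast?_reverse]
  rw [typ_mul, h]
  intro k hk
  rw [h, List.getLast?_append] at hk
  obtain rfl : i = k := by simpa using hk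
  exact hv

/-- The type of `x⁻¹ * y` depends on the `M i`-components only through whether they agree, which `τ`
preserves. Exceptions to right equivariance lie in the finite factor `M i` itself. -/
theorem twistPerm_mem_treeGroup [∀ i, Finite (M i)] (i : ι) (τ : Equiv.Perm (M i)) :
    twistPerm i τ ∈ treeGroup M := by
  refine ⟨fun x y => ?_, fun j s => ?_⟩
  · obtain ⟨u, hu, hx⟩ := exists_firstLetter_mul i x
    obtain ⟨v, hv, hy⟩ := exists_firstLetter_mul i y
    have key : ∀ a b : M i, (CoprodI.of a * u)⁻¹ * (CoprodI.of b * v) =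
        u⁻¹ * CoprodI.of (a⁻¹ * b) * v := fun a b => by
      rw [map_mul, map_inv]
      group
    change typ ((twist i τ x)⁻¹ * twist i τ y) = _
    rw [hx, hy, twist_of_mul _ _ hu, twist_of_mul _ _ hv, key, key]
    by_cases hab : firstLetter i x = firstLetter i y
    · rw [hab, inv_mul_cancel, inv_mul_cancel]
    · rw [typ_inv_mul_of_mul _ hu hv, typ_inv_mul_of_mul _ hu hv]
      · rwa [Ne, inv_mul_eq_one]
      · rwa [Ne, inv_mul_eq_one, τ.apply_eq_iff_eq]
  · refine (Set.finite_range (CoprodI.of : M i →* CoprodI M)).subset fun x hx => ?_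
    obtain ⟨t, ht, hxt⟩ := exists_firstLetter_mul i x
    by_cases ht1 : t = 1
    · exact ⟨firstLetter i x, (hxt.trans (by rw [ht1, mul_one])).symm⟩
    · refine absurd ?_ hx
      change twist i τ (x * CoprodI.of s) = twist i τ x * CoprodI.of s
      rw [hxt, mul_assoc, twist_of_mul _ _ ht,
        twist_of_mul _ _ (head?_typ_mul_of_ne_some ht1 ht j s), mul_assoc]

theorem exists_twist_mem_fixingSubgroup [∀ i, Finite (M i)] {i : ι} {τ : Equiv.Perm (M i)}
    (hτ1 : τ 1 = 1) (hτ : τ ≠ 1) :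
    ∃ H ∈ halfSpaces M, ∃ g ∈ fixingSubgroup (treeGroup M) Hᶜ, g ≠ 1 := by
  refine ⟨branch i 1, branch_mem_halfSpaces i 1,
    ⟨twistPerm i τ, twistPerm_mem_treeGroup i τ⟩, ?_, ?_⟩
  · rw [mem_fixingSubgroup_iff]
    intro x hx
    have hx' : (typ x).head? ≠ some i := by
      rwa [Set.mem_compl_iff, mem_branch, inv_one, one_mul] at hx
    have := twist_of_mul τ 1 hx'
    rwa [hτ1, map_one, one_mul] at this
  · intro h
    refine hτ (Equiv.ext fun a => ?_)
    have h1 : twist i τ (CoprodI.of a) = CoprodI.of a :=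
      DFunLike.congr_fun (congrArg Subtype.val h) (CoprodI.of a)
    have h2 := twist_of_mul (u := 1) τ a (by simp)
    rw [mul_one, mul_one, h1] at h2
    exact (CoprodI.of_injective i h2).symm

theorem isHalfSpaceSystem_halfSpaces [∀ i, Nontrivial (M i)] [∀ i, Finite (M i)]
    (hι : ∀ i j : ι, ∃ k, k ≠ i ∧ k ≠ j) {i : ι} {τ : Equiv.Perm (M i)} (hτ1 : τ 1 = 1)
    (hτ : τ ≠ 1) : IsHalfSpaceSystem (treeGroup M) (halfSpaces M) where
  smul_mem g H hH := by
    obtain ⟨i, x, rfl | rfl⟩ := hH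
    · exact ⟨i, g • x, Or.inl (smul_branch g i x)⟩
    · exact ⟨i, g • x, Or.inr (by rw [Set.smul_set_compl, smul_branch])⟩
  compl_mem _ := compl_mem_halfSpaces
  nested _ hH _ hK := halfSpaces_nested hH hK
  exists_disjoint_smul _ := exists_disjoint_smul_halfSpace hι
  exists_smul_subset _ hH _ hK := exists_smul_halfSpace_subset hι hH hK
  exists_mem_fixingSubgroup := exists_twist_mem_fixingSubgroup hτ1 hτ

/-- The type-preserving permutations that fix `1` and commute with right multiplication by letters
at all words of length at least `n`. -/
def stabilizerLevel (M : ι → Type*) [∀ i, Group (M i)] [∀ i, DecidableEq (M i)] (n : ℕ) :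
    Subgroup (Equiv.Perm (CoprodI M)) where
  carrier := {g | (∀ x, typ (g x) = typ x) ∧ ∀ x, n ≤ (typ x).length →
    ∀ i (s : M i), g (x * CoprodI.of s) = g x * CoprodI.of s}
  one_mem' := ⟨fun _ => rfl, fun _ _ _ _ => rfl⟩
  mul_mem' := by
    rintro g h ⟨hg, hg'⟩ ⟨hh, hh'⟩
    refine ⟨fun x => (hg _).trans (hh _), fun x hx i s => ?_⟩
    rw [Equiv.Perm.mul_apply, Equiv.Perm.mul_apply, hh' x hx, hg' _ (by rwa [hh])]
  inv_mem' := by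
    rintro g ⟨hg, hg'⟩
    have h1 : ∀ x, typ (g⁻¹ x) = typ x := fun x => by
      rw [← hg, Equiv.Perm.coe_inv, g.apply_symm_apply]
    refine ⟨h1, fun x hx i s => ?_⟩
    rw [Equiv.Perm.inv_eq_iff_eq, hg' _ (by rwa [h1]), Equiv.Perm.coe_inv, g.apply_symm_apply]

theorem monotone_stabilizerLevel : Monotone (stabilizerLevel M) :=
  fun _ _ h _ hg => ⟨hg.1, fun x hx => hg.2 x (h.trans hx)⟩

/-- An element preserves the finite ball of radius `n` and is determined by its action there, since
longer words are reached by adding letters on the right. -/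
theorem finite_stabilizerLevel [Finite ι] [∀ i, Finite (M i)] (n : ℕ) :
    Finite (stabilizerLevel M n) := by
  let B := {x : CoprodI M | (typ x).length ≤ n}
  have hB : Finite B := finite_setOf_length_typ_le n
  have hmem : ∀ (g : stabilizerLevel M n) (x : B), (g : Equiv.Perm (CoprodI M)) x ∈ B :=
    fun g x => by
      change (typ _).length ≤ n
      rw [g.2.1]
      exact x.2
  refine Finite.of_injective (fun g (x : B) => (⟨_, hmem g x⟩ : B)) fun g h hgh => ?_
  have hball : ∀ x ∈ B, (g : Equiv.Perm (CoprodI M)) x = (h : Equiv.Perm (CoprodI M)) x :=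
    fun x hx => congrArg Subtype.val (congrFun hgh ⟨x, hx⟩)
  have key : ∀ m x, (typ x).length ≤ n + m →
      (g : Equiv.Perm (CoprodI M)) x = (h : Equiv.Perm (CoprodI M)) x := by
    intro m
    induction m with
    | zero => exact hball
    | succ m ih =>
      intro x hx
      by_cases hxn : (typ x).length ≤ n
      · exact hball x hxn
      have hx1 : x ≠ 1 := by
        rintro rfl
        simp at hxn
      obtain ⟨y, i, s, rfl, hs, hy⟩ := exists_eq_mul_of hx1
      rw [typ_mul_of hs hy, List.length_append, List.length_singleton] at hx hxn
      have hny : n ≤ (typ y).length := by omega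
      rw [g.2.2 y hny, h.2.2 y hny, ih y (by omega)]
  exact Subtype.ext (Equiv.ext fun x => key _ x (Nat.le_add_left _ _))

theorem exists_mem_stabilizerLevel [Finite ι] [∀ i, Finite (M i)] {g : treeGroup M}
    (hg : g • (1 : CoprodI M) = 1) : ∃ n, (g : Equiv.Perm (CoprodI M)) ∈ stabilizerLevel M n := by
  set f : Equiv.Perm (CoprodI M) := ↑g with hf
  have hfin : (⋃ p : Σ i, M i, {x | f (x * CoprodI.of p.2) ≠ f x * CoprodI.of p.2}).Finite :=
    Set.finite_iUnion fun p => g.2.2 p.1 p.2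
  obtain ⟨n, hn⟩ := (hfin.image fun x => (typ x).length).bddAbove
  -- `n` bounds the lengths of all exceptional words, so none has length `n + 1` or more.
  refine ⟨n + 1, fun x => ?_, fun x hx i s => ?_⟩
  · have := typ_smul g 1 x
    rwa [hg, inv_one, one_mul, one_mul] at this
  · by_contra h
    exact absurd (hn ⟨x, Set.mem_iUnion.2 ⟨⟨i, s⟩, h⟩, rfl⟩) (by simpa using hx)

end TreeGroup

end NCJI

end

noncomputable section

namespace NCJI

/-! ### The two examples -/

section Examples

theorem IsJustInfinite.of_isSimpleGroup {Γ : Type*} [Group Γ] [Infinite Γ] [IsSimpleGroup Γ] :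
    IsJustInfinite Γ := by
  refine ⟨inferInstance, fun N hN hN' => ?_⟩
  rw [(IsSimpleGroup.eq_bot_or_eq_top_of_normal N hN).resolve_left hN']
  infer_instance

open Monoid

/-- The letters of the free product `(ℤ/3) * (ℤ/3) * (ℤ/3)`. -/
abbrev Letters (_ : Fin 3) : Type := Multiplicative (ZMod 3)

theorem isHalfSpaceSystem_letters : IsHalfSpaceSystem (treeGroup Letters) (halfSpaces Letters) := by
  -- The local permutation must fix the identity and be nontrivial, so a factor needs at least three
  -- elements; inversion on `ℤ/3` serves.
  refine isHalfSpaceSystem_halfSpaces (by decide) (i := 0)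
    (τ := (Equiv.inv (Multiplicative (ZMod 3)) : Equiv.Perm (Letters 0))) inv_one fun h => ?_
  have h1 : (Multiplicative.ofAdd (1 : ZMod 3))⁻¹ = Multiplicative.ofAdd 1 :=
    DFunLike.congr_fun h (Multiplicative.ofAdd (1 : ZMod 3))
  exact absurd h1 (by decide)

theorem disjoint_branch {ι : Type*} [DecidableEq ι] {M : ι → Type*} [∀ i, Group (M i)]
    [∀ i, DecidableEq (M i)] {i j : ι} (hij : i ≠ j) (x : CoprodI M) :
    Disjoint (branch i x) (branch j x) :=
  Set.disjoint_left.2 fun _ hz hz' => hij (Option.some.inj (hz.symm.trans hz'))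

theorem not_isAmenable_monolith_treeGroup : ¬ IsAmenable (monolith (treeGroup Letters)) := by
  refine not_isAmenable_of_compression (X := CoprodI Letters) (𝓗 := halfSpaces Letters) 1
    (fun H hH K hK => ?_) (fun _ => compl_mem_halfSpaces) (branch_mem_halfSpaces 0 1)
    (branch_mem_halfSpaces 1 1) (branch_mem_halfSpaces 2 1) (disjoint_branch (by decide) 1)
    (disjoint_branch (by decide) 1) (disjoint_branch (by decide) 1)
  obtain ⟨m, hm, hmH⟩ := isHalfSpaceSystem_letters.compresses_monolith H hH K hK
  exact ⟨⟨m, hm⟩, hmH⟩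

theorem not_isCStarSimple_monolith_treeGroup :
    ¬ IsCStarSimple (monolith (treeGroup Letters)) := by
  let φ := (treeGroup Letters).subtype.comp (monolith (treeGroup Letters)).subtype
  have hφ : Function.Injective φ := Subtype.val_injective.comp Subtype.val_injective
  have hfin : ∀ n, Finite ((stabilizerLevel Letters n).comap φ) := fun n => by
    have := finite_stabilizerLevel (M := Letters) n
    exact Finite.of_injective (fun g => (⟨φ g, g.2⟩ : stabilizerLevel Letters n))
      fun g h hgh => Subtype.ext (hφ (Subtype.mk.inj hgh))
  have hH := branch_mem_halfSpaces (M := Letters) 0 1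
  -- Nontrivial elements of the monolith supported in a half-space and in its complement have
  -- disjoint supports.
  obtain ⟨a, ha, haH, ha1⟩ := isHalfSpaceSystem_letters.exists_mem_monolith hH
  obtain ⟨b, hb, hbH, hb1⟩ :=
    isHalfSpaceSystem_letters.exists_mem_monolith (compl_mem_halfSpaces hH)
  rw [compl_compl] at hbH
  rw [mem_fixingSubgroup_iff] at haH hbH
  refine not_isCStarSimple_of_locally_finite_stabilizer (X := CoprodI Letters) (x₀ := 1)
    (L := fun n => (stabilizerLevel Letters n).comap φ)
    (fun m n h => Subgroup.comap_mono (monotone_stabilizerLevel h))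
    (fun g hg => exists_mem_stabilizerLevel (g := g.1) hg) (a := ⟨a, ha⟩) (b := ⟨b, hb⟩)
    (fun h => ha1 (congrArg Subtype.val h)) (fun h => hb1 (congrArg Subtype.val h)) fun x => ?_
  by_cases hx : x ∈ branch 0 1
  · exact Or.inr (hbH x hx)
  · exact Or.inl (haH x hx)

theorem exists_isSimpleGroup_not_isNCJustInfinite :
    ∃ (Γ : Type) (_ : Group Γ), IsSimpleGroup Γ ∧ ¬ IsAmenable Γ ∧ IsJustInfinite Γ ∧
      ¬ IsNCJustInfinite Γ := by
  have hsimple := isHalfSpaceSystem_letters.isSimpleGroup_monolith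
  have hinf : Infinite (monolith (treeGroup Letters)) :=
    not_finite_iff_infinite.1 fun _ => not_isAmenable_monolith_treeGroup isAmenable_of_finite
  exact ⟨monolith (treeGroup Letters), inferInstance, hsimple, not_isAmenable_monolith_treeGroup,
    .of_isSimpleGroup, fun h => h.isAmenable_or_isCStarSimple.elim
      not_isAmenable_monolith_treeGroup not_isCStarSimple_monolith_treeGroup⟩

theorem isJustInfinite_multiplicative_int : IsJustInfinite (Multiplicative ℤ) := by
  refine ⟨inferInstance, fun N _ hN => ?_⟩
  obtain ⟨g, hg, hg1⟩ := N.bot_or_exists_ne_one.resolve_left hN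
  have hle : (AddSubgroup.zmultiples g.toAdd).toSubgroup ≤ N := by
    rintro _ ⟨k, rfl⟩
    exact N.zpow_mem hg k
  have : (AddSubgroup.zmultiples g.toAdd).toSubgroup.FiniteIndex := by
    refine ⟨?_⟩
    rw [AddSubgroup.index_toSubgroup, Int.index_zmultiples, Int.natAbs_ne_zero]
    exact hg1
  exact Subgroup.finiteIndex_of_le hle

theorem not_isICC_of_comm {Γ : Type*} [CommGroup Γ] [Nontrivial Γ] : ¬ IsICC Γ := by
  intro h
  obtain ⟨g, hg⟩ := exists_ne (1 : Γ)
  refine h g hg ((Set.finite_singleton g).subset fun x hx => ?_)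
  exact (isConj_iff_eq.1 hx).symm

end Examples

end NCJI

end

theorem proposition2 :
    (∀ (Γ : Type*) [Group Γ], NCJI.IsNCJustInfinite Γ →
      (NCJI.IsAmenable Γ ∨ NCJI.IsCStarSimple Γ) ∧ NCJI.IsICC Γ) ∧
    (∃ (Γ : Type) (_ : Group Γ), IsSimpleGroup Γ ∧ ¬ NCJI.IsAmenable Γ ∧
      NCJI.IsJustInfinite Γ ∧ ¬ NCJI.IsNCJustInfinite Γ) ∧
    (NCJI.IsJustInfinite (Multiplicative ℤ) ∧ ¬ NCJI.IsNCJustInfinite (Multiplicative ℤ)) :=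
  ⟨fun _ _ h => ⟨h.isAmenable_or_isCStarSimple, h.isICC⟩,
    NCJI.exists_isSimpleGroup_not_isNCJustInfinite, NCJI.isJustInfinite_multiplicative_int,
    fun h => NCJI.not_isICC_of_comm h.isICC⟩
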